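/- Fix $\lambda>0$. For each integer $x$ let $e_x=\langle x,x+1\rangle$ be the corresponding edge of $\mathbb Z$, and attach to it five Poisson processes on $[0,\infty)$: $\mathcal L_r(e_x)$, $\mathcal L_\ell(e_x)$ (left arrows) and $\mathcal R_r(e_x)$, $\mathcal R_\ell(e_x)$ (right arrows), each of intensity $\tfrac12\,dt$, and $\mathcal N_{e_x}$ (nucleations), of intensity $\lambda\,dt$; all these processes, over all edges and all five kinds, are independent. The homogeneous Randomized Poly-Nuclear Growth process is the system of $\ell$-particles and $r$-particles on $\mathbb Z$ which starts from the empty configuration at time $0$ and in which the marks of these processes act in chronological order as follows. - A right (resp. left) arrow of type $r$ on $\langle x,x+1\rangle$: if there is at least one $r$-particle at $x$ (resp. at $x+1$), one of them jumps to $x+1$ (resp. to $x$); if there are $\ell$-particles at the target site, the jumping particle and one of them annihilate instantaneously. Arrows of type $\ell$ act in the same way on $\ell$-particles, with the roles of $\ell$ and $r$ exchanged. - A nucleation on $\langle x,x+1\rangle$: an $\ell$-particle appears at $x$ and an $r$-particle appears at $x+1$; each of them annihilates instantaneously with a particle of the opposite type if there is one at its site. (Almost surely, for every $t$ there are, arbitrarily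 far to the left and to the right, edges without any mark up to time $t$; between two such edges there are only finitely many marks up to time $t$, at distinct times, and the evolution there up to time $t$ does not depend on the marks outside, so the process is well defined.) Let $\mathcal N_{e_0}(t)$ be the number of nucleations on $e_0=\langle 0,1\rangle$ up to time $t$, and let $\phi^\ell_t$ (resp. $\phi^r_t$) be the number of jumps of $\ell$-particles (resp. $r$-particles) from $0$ to $1$ minus the number of those from $1$ to $0$ up to time $t$. Let $$h_t(e_0)=\mathcal N_{e_0}(t)-\phi^\ell_t+\phi^r_t$$ be the height above $e_0$ at time $t$. Then, almost surely, $$\lim_{t\to\infty}\frac{h_t(e_0)}{t}=\lambda .$$ -/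

import Mathlib

open MeasureTheory ProbabilityTheory Filter Topology
open scoped NNReal

noncomputable section

namespace RPNG

/-- `N` is (the counting process of) a Poisson process on `[0, ∞)` with intensity `rate · dt`:
almost surely it starts at `0` and has nondecreasing right-continuous paths, and it has independent
increments with Poisson laws. -/
structure IsPoissonProcess {Ω : Type*} [MeasurableSpace Ω] (N : ℝ≥0 → Ω → ℕ) (rate : ℝ≥0)
    (P : Measure Ω) : Prop where
  measurable : ∀ t, Measurable (N t)
  zero : ∀ᵐ ω ∂P, N 0 ω = 0
  mono : ∀ᵐ ω ∂P, Monotone fun t => N t ω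
  rightCont : ∀ᵐ ω ∂P, ∀ t, ContinuousWithinAt (fun s => N s ω) (Set.Ici t) t
  indep : HasIndepIncrements N P
  law : ∀ s t, s ≤ t → HasLaw (fun ω => N t ω - N s ω) (poissonMeasure (rate * (t - s))) P

/-- The five kinds of marks: left and right arrows acting on `r`-particles or on `ℓ`-particles,
and nucleations. -/
inductive MarkKind
  | leftArrowR
  | leftArrowL
  | rightArrowR
  | rightArrowL
  | nucleation

/-- Every arrow process has intensity `1/2`; nucleations have intensity `lam`. -/
def MarkKind.rate (lam : ℝ≥0) : MarkKind → ℝ≥0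
  | .nucleation => lam
  | _ => 1 / 2

/-- A family of Poisson processes `N k x`, one for each kind `k` of mark and each edge
`⟨x, x + 1⟩` of `ℤ`, all of them independent, with the intensities of the homogeneous process. -/
structure IsPoissonSystem {Ω : Type*} [MeasurableSpace Ω]
    (N : MarkKind → ℤ → ℝ≥0 → Ω → ℕ) (lam : ℝ≥0) (P : Measure Ω) : Prop where
  poisson : ∀ k x, IsPoissonProcess (N k x) (k.rate lam) P
  indep : iIndepFun (fun (i : MarkKind × ℤ) (ω : Ω) (t : ℝ≥0) => N i.1 i.2 t ω) P

/-! ### Action of a single mark -/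

/-- A particle configuration, together with the net flow of particles through every edge (counted
positively to the right); the edge `⟨x, x + 1⟩` is represented by `x`. -/
structure State where
  /-- number of `ℓ`-particles at each site -/
  left : ℤ → ℕ
  /-- number of `r`-particles at each site -/
  right : ℤ → ℕ
  /-- net flow of `ℓ`-particles through each edge -/
  flowL : ℤ → ℤ
  /-- net flow of `r`-particles through each edge -/
  flowR : ℤ → ℤ

/-- No particle, no flow. -/
def State.empty : State := ⟨0, 0, 0, 0⟩

/-- An `ℓ`-particle arrives at `x`; it annihilates with an `r`-particle if there is one. -/
def State.addL (S : State) (x : ℤ) : State :=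
  if 0 < S.right x then { S with right := Function.update S.right x (S.right x - 1) }
  else { S with left := Function.update S.left x (S.left x + 1) }

/-- An `r`-particle arrives at `x`; it annihilates with an `ℓ`-particle if there is one. -/
def State.addR (S : State) (x : ℤ) : State :=
  if 0 < S.left x then { S with left := Function.update S.left x (S.left x - 1) }
  else { S with right := Function.update S.right x (S.right x + 1) }

/-- If there is an `ℓ`-particle at `src`, one of them jumps to `dst` through the edge `e`, and the
flow through `e` changes by `sgn`. -/
def State.jumpL (S : State) (src dst e sgn : ℤ) : State :=
  if 0 < S.left src then
    State.addL { S with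
      left := Function.update S.left src (S.left src - 1)
      flowL := Function.update S.flowL e (S.flowL e + sgn) } dst
  else S

/-- If there is an `r`-particle at `src`, one of them jumps to `dst` through the edge `e`, and the
flow through `e` changes by `sgn`. -/
def State.jumpR (S : State) (src dst e sgn : ℤ) : State :=
  if 0 < S.right src then
    State.addR { S with
      right := Function.update S.right src (S.right src - 1)
      flowR := Function.update S.flowR e (S.flowR e + sgn) } dst
  else S

/-- The action of a mark of kind `k` on the edge `⟨x, x + 1⟩`. -/
def State.act (S : State) (k : MarkKind) (x : ℤ) : State :=
  match k with
  | .leftArrowR => S.jumpR (x + 1) x x (-1)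
  | .leftArrowL => S.jumpL (x + 1) x x (-1)
  | .rightArrowR => S.jumpR x (x + 1) x 1
  | .rightArrowL => S.jumpL x (x + 1) x 1
  | .nucleation => (S.addL x).addR (x + 1)

/-! ### Graphical construction in a fixed environment

Here `N k x : ℝ≥0 → ℕ` is the counting function of the marks of kind `k` on `⟨x, x + 1⟩`. -/

/-- A mark: its time, its kind and its edge. -/
structure Mark where
  time : ℝ≥0
  kind : MarkKind
  edge : ℤ

/-- The mark `m` occurs in the environment: its counting function jumps at its time. -/
def Mark.Occurs (N : MarkKind → ℤ → ℝ≥0 → ℕ) (m : Mark) : Prop :=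
  0 < m.time ∧ ∀ s < m.time, N m.kind m.edge s < N m.kind m.edge m.time

/-- The edge `⟨a, a + 1⟩` carries no mark of any kind up to time `t`. -/
def Unmarked (N : MarkKind → ℤ → ℝ≥0 → ℕ) (t : ℝ≥0) (a : ℤ) : Prop :=
  ∀ m : Mark, m.Occurs N → m.edge = a → t < m.time

/-- The marks up to time `t` on the edges strictly between `⟨a, a + 1⟩` and `⟨b, b + 1⟩`. -/
def blockMarks (N : MarkKind → ℤ → ℝ≥0 → ℕ) (a b : ℤ) (t : ℝ≥0) : Set Mark :=
  {m | m.Occurs N ∧ m.time ≤ t ∧ a < m.edge ∧ m.edge < b}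

open Classical in
/-- The marks of `blockMarks N a b t` in chronological order (if there are finitely many). -/
def blockList (N : MarkKind → ℤ → ℝ≥0 → ℕ) (a b : ℤ) (t : ℝ≥0) : List Mark :=
  if h : (blockMarks N a b t).Finite then
    h.toFinset.toList.insertionSort fun m m' => m.time ≤ m'.time
  else []

/-- The state at time `t`, started from the empty configuration at time `0` and subjected to the
marks strictly between `⟨a, a + 1⟩` and `⟨b, b + 1⟩`, one after the other. -/
def blockState (N : MarkKind → ℤ → ℝ≥0 → ℕ) (a b : ℤ) (t : ℝ≥0) : State :=
  (blockList N a b t).foldl (fun S m => S.act m.kind m.edge) State.empty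

/-- `p = (a, b)` is a pair of edges, to the left and to the right of `⟨x, x + 1⟩`, which carry no
mark up to time `t`. -/
def Isolates (N : MarkKind → ℤ → ℝ≥0 → ℕ) (x : ℤ) (t : ℝ≥0) (p : ℤ × ℤ) : Prop :=
  p.1 < x ∧ x < p.2 ∧ Unmarked N t p.1 ∧ Unmarked N t p.2

open Classical in
/-- The height `h_t(⟨x, x + 1⟩)`: nucleations at the edge up to time `t`, minus the net flow of
`ℓ`-particles, plus the net flow of `r`-particles through it. The flows are computed in a block
delimited by two edges without marks up to time `t`, outside of which nothing has any influence on
the block up to time `t`; almost surely such edges exist for all `x` and `t`, and all choices of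
them give the same value. (The value is `0` if there are no such edges.) -/
def height (N : MarkKind → ℤ → ℝ≥0 → ℕ) (x : ℤ) (t : ℝ≥0) : ℤ :=
  if h : ∃ p, Isolates N x t p then
    (N .nucleation x t : ℤ) - (blockState N h.choose.1 h.choose.2 t).flowL x
      + (blockState N h.choose.1 h.choose.2 t).flowR x
  else 0

end RPNG

end

noncomputable section

namespace RPNG

/-! The particles are the discrete gradient of the heights. Because `ℓ`- and `r`-particles never
share a site, the sign of `h (x - 1) - h x` tells which type is present at `x`. The heights are
therefore autonomous (`State.HasHeights.act`): nucleations add one, and an arrow moves a height one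
unit towards a neighbouring height.

On a finite cycle this dynamics has three decisive features. All four arrow kinds have equal rates,
so their contributions to the total height cancel in expectation. From flat heights, translation
invariance then makes every mean height grow at exactly the nucleation rate (`meanHeight_flat`).
Each mark acts monotonically and commutes with adding a constant, so a single mark changes the
expected later heights by amounts of one sign, at most one each, whose absolute values sum to at
most one (`sum_sq_meanHeight_sub_le`). The law of total variance, applied step by step, bounds the
sum of the variances over the cycle by the expected number of marks (`sum_variance_le`). By
translation invariance each variance is at most of order `t`, uniformly in the length of the cycle
(`variance_flat_le`).

The infinite system is compared with a cycle of `2 L + 1` edges. If some edge on each side of the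
origin carries no mark up to time `t`, the origin sees neither the rest of `ℤ` nor the closure of
the cycle. Cutting `[0, t]` into `m` intervals with at most one mark each turns the evolution into
the discrete chain (`GoodEnv.height_eq_chainHeight`). Letting `m → ∞`, then `L → ∞`, yields the
Chebyshev bound `measureReal_height_le`.

Borel–Cantelli gives convergence along `t = n ^ 2`. Between squares the height moves by at most the
number of marks on the edge, which is `o(n ^ 2)` by the law of large numbers for Poisson processes
(`tendsto_div_of_tendsto_sq`). -/

instance : DecidableEq MarkKind := fun a b => by
  cases a <;> cases b <;> first | exact isTrue rfl | exact isFalse (by simp)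

instance : Fintype MarkKind :=
  ⟨{.leftArrowR, .leftArrowL, .rightArrowR, .rightArrowL, .nucleation}, by
    rintro (_ | _ | _ | _ | _) <;> simp⟩

lemma MarkKind.sum_univ {M : Type*} [AddCommMonoid M] (f : MarkKind → M) :
    ∑ k, f k = f .leftArrowR + (f .leftArrowL + (f .rightArrowR + (f .rightArrowL
      + f .nucleation))) := by
  have : (Finset.univ : Finset MarkKind) =
    {.leftArrowR, .leftArrowL, .rightArrowR, .rightArrowL, .nucleation} := rfl
  rw [this]
  simp

/-! ### The height dynamics

The heights above the edges form an autonomous process: a nucleation raises the height of its edge,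
and an arrow moves it one unit towards the height of a neighbouring edge. The set `V` of edges is
`ℤ` or a cycle `ZMod n`. -/

section Dynamics

variable {V : Type*} [CommRing V]

/-- The change of the height of the edge `x` under a mark of kind `k` on `x`. -/
def growth (k : MarkKind) (x : V) (h : V → ℤ) : ℤ :=
  match k with
  | .leftArrowR => if h (x + 1) < h x then -1 else 0
  | .leftArrowL => if h x < h (x + 1) then 1 else 0
  | .rightArrowR => if h x < h (x - 1) then 1 else 0
  | .rightArrowL => if h (x - 1) < h x then -1 else 0
  | .nucleation => 1

lemma abs_growth_le (k : MarkKind) (x : V) (h : V → ℤ) : |growth k x h| ≤ 1 := by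
  cases k <;> simp only [growth] <;> (try split_ifs) <;> simp

/-- The moves caused by the arrows cancel out over the whole cycle. -/
lemma sum_growth_arrows [Fintype V] (h : V → ℤ) :
    ∑ x, growth .leftArrowR x h + (∑ x, growth .leftArrowL x h + (∑ x, growth .rightArrowR x h
      + ∑ x, growth .rightArrowL x h)) = 0 := by
  have e1 : ∑ x : V, growth .rightArrowR x h = ∑ x : V, if h (x + 1) < h x then (1 : ℤ) else 0 := by
    rw [← Equiv.sum_comp (Equiv.addRight (1 : V))]
    simp [growth]
  have e2 : ∑ x : V, growth .rightArrowL x h =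
      ∑ x : V, if h x < h (x + 1) then (-1 : ℤ) else 0 := by
    rw [← Equiv.sum_comp (Equiv.addRight (1 : V))]
    simp [growth]
  rw [e1, e2, ← Finset.sum_add_distrib, ← Finset.sum_add_distrib, ← Finset.sum_add_distrib]
  refine Finset.sum_eq_zero fun x _ => ?_
  simp only [growth]
  split_ifs <;> simp

variable [DecidableEq V]

/-- The action on the heights of a mark of kind `k` on the edge `x`. -/
def heightStep (k : MarkKind) (x : V) (h : V → ℤ) : V → ℤ :=
  h + Pi.single x (growth k x h)

lemma heightStep_apply (k : MarkKind) (x : V) (h : V → ℤ) (y : V) :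
    heightStep k x h y = h y + if y = x then growth k x h else 0 := by
  simp [heightStep, Pi.single_apply]


/-- A given kind of mark either only raises or only lowers, by at most one. If the two heights at
`x` differ, integrality prevents a crossing; if they agree, the neighbour's order forces the move in
the configuration that has to follow. -/
lemma heightStep_mono (k : MarkKind) (x : V) : Monotone (heightStep k x) := by
  intro h h' hh y
  rw [heightStep_apply, heightStep_apply]
  have h0 : h y ≤ h' y := hh y
  split_ifs with hy
  · subst hy
    have h1 : h (y + 1) ≤ h' (y + 1) := hh (y + 1)
    have h2 : h (y - 1) ≤ h' (y - 1) := hh (y - 1)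
    cases k <;> simp only [growth] <;> (try split_ifs) <;> omega
  · simpa using h0

lemma heightStep_add_one (k : MarkKind) (x : V) (h : V → ℤ) :
    heightStep k x (h + 1) = heightStep k x h + 1 := by
  have : growth k x (h + 1) = growth k x h := by cases k <;> simp [growth]
  ext y
  simp only [heightStep_apply, Pi.add_apply, Pi.one_apply, this]
  ring

lemma heightStep_shift (k : MarkKind) (x y : V) (h : V → ℤ) :
    heightStep k x (fun z => h (z + y)) = fun z => heightStep k (x + y) h (z + y) := by
  have : growth k x (fun z => h (z + y)) = growth k (x + y) h := by
    cases k <;> simp [growth, add_right_comm, sub_add_eq_add_sub]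
  ext z
  simp [heightStep_apply, this]

/-- This sandwich is what monotonicity and commutation with `+ 1` can propagate through the later
steps. -/
lemma le_heightStep_or (k : MarkKind) (x : V) (h : V → ℤ) :
    (h ≤ heightStep k x h ∧ heightStep k x h ≤ h + 1) ∨
      (heightStep k x h ≤ h ∧ h ≤ heightStep k x h + 1) := by
  have hg := abs_le.1 (abs_growth_le k x h)
  rcases le_total 0 (growth k x h) with h0 | h0
  · left
    constructor <;> intro y <;> simp only [heightStep_apply, Pi.add_apply, Pi.one_apply] <;>
      split_ifs <;> omega
  · right
    constructor <;> intro y <;> simp only [heightStep_apply, Pi.add_apply, Pi.one_apply] <;>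
      split_ifs <;> omega

lemma abs_heightStep_sub_le (k : MarkKind) (x y : V) (h : V → ℤ) :
    |heightStep k x h y - h y| ≤ if x = y then 1 else 0 := by
  rw [heightStep_apply]
  rcases eq_or_ne y x with rfl | hxy
  · simpa using abs_growth_le k y h
  · simp [hxy, hxy.symm]

variable [Fintype V]

lemma sum_heightStep (k : MarkKind) (x : V) (h : V → ℤ) :
    ∑ y, heightStep k x h y = ∑ y, h y + growth k x h := by
  simp [heightStep_apply, Finset.sum_add_distrib]

end Dynamics

/-! ### The Markov chain of the heights on a finite cycle -/

section Chain

/-- Weights of a step of the chain: `q k` is the probability that the step is a mark of kind `k` on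
any given edge. All kinds of arrows have the same weight. -/
structure IsStepWeight (V : Type*) [Fintype V] (q : MarkKind → ℝ) : Prop where
  nonneg : ∀ k, 0 ≤ q k
  arrow : ∀ k, k ≠ .nucleation → q k = q .leftArrowR
  sum_le : ∑ i : MarkKind × V, q i.1 ≤ 1

lemma sum_weights {V : Type*} [Fintype V] {q : MarkKind → ℝ} (hq : IsStepWeight V q) :
    ∑ i : MarkKind × V, q i.1 = Fintype.card V * (4 * q .leftArrowR + q .nucleation) := by
  rw [Fintype.sum_prod_type]
  simp only [Finset.sum_const, Finset.card_univ, nsmul_eq_mul, ← Finset.mul_sum,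
    MarkKind.sum_univ]
  rw [hq.arrow .leftArrowL (by simp), hq.arrow .rightArrowR (by simp),
    hq.arrow .rightArrowL (by simp)]
  ring

variable {V : Type*} [CommRing V] [DecidableEq V] [Fintype V]

/-- The transition operator: nothing happens with the remaining probability. -/
def transition (q : MarkKind → ℝ) (g : (V → ℤ) → ℝ) (h : V → ℤ) : ℝ :=
  (1 - ∑ i : MarkKind × V, q i.1) * g h + ∑ i : MarkKind × V, q i.1 * g (heightStep i.1 i.2 h)

variable {q : MarkKind → ℝ}

lemma transition_add (g g' : (V → ℤ) → ℝ) :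
    transition q (g + g') = transition q g + transition q g' := by
  ext h
  simp only [transition, Pi.add_apply, mul_add, Finset.sum_add_distrib]
  ring

lemma transition_smul (c : ℝ) (g : (V → ℤ) → ℝ) :
    transition q (c • g) = c • transition q g := by
  ext h
  simp only [transition, Pi.smul_apply, smul_eq_mul, mul_add, Finset.mul_sum]
  congr 1
  · ring
  · exact Finset.sum_congr rfl fun i _ => by ring

/-- The transition operator as a linear map. -/
def transitionLM (q : MarkKind → ℝ) : ((V → ℤ) → ℝ) →ₗ[ℝ] ((V → ℤ) → ℝ) where
  toFun := transition q
  map_add' := transition_add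
  map_smul' := transition_smul

lemma transitionLM_pow (m : ℕ) (g : (V → ℤ) → ℝ) :
    (transitionLM q ^ m) g = (transition q)^[m] g :=
  Module.End.pow_apply (transitionLM q) m g

lemma transition_const (c : ℝ) : transition q (fun _ : V → ℤ => c) = fun _ => c := by
  ext h
  simp only [transition, ← Finset.sum_mul]
  ring

lemma transition_iterate_const (c : ℝ) (m : ℕ) :
    (transition q)^[m] (fun _ : V → ℤ => c) = fun _ => c :=
  Function.iterate_fixed (transition_const c) m

lemma transition_le (hq : IsStepWeight V q) {g g' : (V → ℤ) → ℝ} (hg : g ≤ g') :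
    transition q g ≤ transition q g' := by
  intro h
  refine add_le_add (mul_le_mul_of_nonneg_left (hg h) (sub_nonneg.2 hq.sum_le)) ?_
  exact Finset.sum_le_sum fun i _ => mul_le_mul_of_nonneg_left (hg _) (hq.nonneg _)

lemma transition_iterate_le (hq : IsStepWeight V q) {g g' : (V → ℤ) → ℝ} (hg : g ≤ g') (m : ℕ) :
    (transition q)^[m] g ≤ (transition q)^[m] g' :=
  Monotone.iterate (f := transition q) (fun _ _ h => transition_le hq h) m hg

lemma transition_monotone (hq : IsStepWeight V q) {g : (V → ℤ) → ℝ} (hg : Monotone g) :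
    Monotone (transition q g) := by
  intro h h' hh
  refine add_le_add (mul_le_mul_of_nonneg_left (hg hh) (sub_nonneg.2 hq.sum_le)) ?_
  exact Finset.sum_le_sum fun i _ =>
    mul_le_mul_of_nonneg_left (hg (heightStep_mono _ _ hh)) (hq.nonneg _)

lemma transition_add_one {g : (V → ℤ) → ℝ} (hg : ∀ h, g (h + 1) = g h + 1) (h : V → ℤ) :
    transition q g (h + 1) = transition q g h + 1 := by
  simp only [transition, heightStep_add_one, hg, mul_add, Finset.sum_add_distrib, mul_one]
  ring

lemma transition_shift (g : (V → ℤ) → ℝ) (y : V) :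
    transition q (fun h => g fun z => h (z + y)) = fun h => transition q g fun z => h (z + y) := by
  ext h
  simp only [transition, heightStep_shift]
  congr 1
  rw [Fintype.sum_prod_type, Fintype.sum_prod_type]
  refine Finset.sum_congr rfl fun k _ => ?_
  exact (Equiv.sum_comp (Equiv.addRight y)
    (fun x => q k * g fun z => heightStep k x h (z + y))).symm

lemma transition_iterate_shift (g : (V → ℤ) → ℝ) (y : V) (m : ℕ) :
    (transition q)^[m] (fun h => g fun z => h (z + y)) =
      fun h => (transition q)^[m] g fun z => h (z + y) := by
  induction m generalizing g with
  | zero => rfl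
  | succ m ih => simp only [Function.iterate_succ_apply, transition_shift, ih]

/-- The expected total height grows at a constant rate, whatever the heights are. -/
lemma transition_sum (hq : IsStepWeight V q) (c : ℝ) :
    transition q (fun h : V → ℤ => ((∑ y, h y : ℤ) : ℝ) + c) =
      fun h => ((∑ y, h y : ℤ) : ℝ) + (c + Fintype.card V * q .nucleation) := by
  ext h
  have key : ∑ i : MarkKind × V, q i.1 * (growth i.1 i.2 h : ℝ) =
      Fintype.card V * q .nucleation := by
    rw [Fintype.sum_prod_type]
    simp only [← Finset.mul_sum, MarkKind.sum_univ]
    rw [hq.arrow .leftArrowL (by simp), hq.arrow .rightArrowR (by simp),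
      hq.arrow .rightArrowL (by simp)]
    have h0 : ((∑ x, growth .leftArrowR x h + (∑ x, growth .leftArrowL x h +
        (∑ x, growth .rightArrowR x h + ∑ x, growth .rightArrowL x h)) : ℤ) : ℝ) = 0 := by
      rw [sum_growth_arrows]; simp
    push_cast at h0
    have h1 : ∑ x : V, (growth .nucleation x h : ℝ) = Fintype.card V := by simp [growth]
    rw [h1]
    linear_combination q .leftArrowR * h0
  simp only [transition, sum_heightStep, Int.cast_add, mul_add, Finset.sum_add_distrib, key,
    ← Finset.sum_mul]
  ring

lemma transition_iterate_sum (hq : IsStepWeight V q) (m : ℕ) :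
    (transition q)^[m] (fun h : V → ℤ => ((∑ y, h y : ℤ) : ℝ)) =
      fun h => ((∑ y, h y : ℤ) : ℝ) + m * (Fintype.card V * q .nucleation) := by
  induction m with
  | zero => simp
  | succ m ih =>
    rw [Function.iterate_succ_apply', ih, transition_sum hq]
    ext h
    push_cast
    ring

/-- The expected height of the edge `y` after `m` steps, as a function of the initial heights. -/
def meanHeight (q : MarkKind → ℝ) (m : ℕ) (y : V) : (V → ℤ) → ℝ :=
  (transition q)^[m] fun h => (h y : ℝ)

lemma meanHeight_succ (m : ℕ) (y : V) :
    meanHeight q (m + 1) y = transition q (meanHeight q m y) :=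
  Function.iterate_succ_apply' _ _ _

lemma meanHeight_monotone (hq : IsStepWeight V q) (m : ℕ) (y : V) :
    Monotone (meanHeight q m y) := by
  induction m with
  | zero => exact fun h h' hh => by simpa [meanHeight] using hh y
  | succ m ih => rw [meanHeight_succ]; exact transition_monotone hq ih

lemma meanHeight_add_one (m : ℕ) (y : V) (h : V → ℤ) :
    meanHeight q m y (h + 1) = meanHeight q m y h + 1 := by
  induction m generalizing h with
  | zero => simp [meanHeight]
  | succ m ih => rw [meanHeight_succ]; exact transition_add_one ih h

lemma sum_meanHeight (hq : IsStepWeight V q) (m : ℕ) (h : V → ℤ) :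
    ∑ y, meanHeight q m y h = ((∑ y, h y : ℤ) : ℝ) + m * (Fintype.card V * q .nucleation) := by
  have h1 := congrFun (transition_iterate_sum hq m) h
  rw [← h1]
  simp only [meanHeight, ← transitionLM_pow]
  rw [← Finset.sum_apply, ← map_sum]
  have e : ∑ y, (fun h : V → ℤ => (h y : ℝ)) = fun h => ((∑ y, h y : ℤ) : ℝ) := by
    ext h
    simp
  rw [e]

/-- By `le_heightStep_or`, monotonicity and `meanHeight_add_one`, the differences all lie in `[0,
1]` or all in `[-1, 0]`. Their squares are thus at most their absolute values, whose sum is the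
change of the total height, at most one in absolute value. -/
lemma sum_sq_meanHeight_sub_le (hq : IsStepWeight V q) (m : ℕ) (k : MarkKind) (x : V)
    (h : V → ℤ) :
    ∑ y, (meanHeight q m y (heightStep k x h) - meanHeight q m y h) ^ 2 ≤ 1 := by
  have hS : ∑ y, (meanHeight q m y (heightStep k x h) - meanHeight q m y h) = growth k x h := by
    rw [Finset.sum_sub_distrib, sum_meanHeight hq, sum_meanHeight hq, sum_heightStep]
    push_cast
    ring
  have hg := abs_le.1 (abs_growth_le k x h)
  have hg1 : (-1 : ℝ) ≤ growth k x h := by exact_mod_cast hg.1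
  have hg2 : (growth k x h : ℝ) ≤ 1 := by exact_mod_cast hg.2
  rcases le_heightStep_or k x h with ⟨h1, h2⟩ | ⟨h1, h2⟩
  · refine le_trans (Finset.sum_le_sum fun y _ => ?_) (hS.le.trans hg2)
    have a1 := meanHeight_monotone hq m y h1
    have a2 := meanHeight_monotone hq m y h2
    rw [meanHeight_add_one] at a2
    nlinarith
  · refine le_trans (Finset.sum_le_sum
      (g := fun y => -(meanHeight q m y (heightStep k x h) - meanHeight q m y h)) fun y _ => ?_) ?_
    · have a1 := meanHeight_monotone hq m y h1
      have a2 := meanHeight_monotone hq m y h2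
      rw [meanHeight_add_one] at a2
      nlinarith
    · rw [Finset.sum_neg_distrib, hS]
      linarith

/-- The variance of one step is at most the second moment about the starting value `g h`; the gap is
the square of the mean displacement. -/
lemma transition_sq_sub_sq_le (g : (V → ℤ) → ℝ) (h : V → ℤ) :
    transition q (g ^ 2) h - transition q g h ^ 2 ≤
      ∑ i : MarkKind × V, q i.1 * (g (heightStep i.1 i.2 h) - g h) ^ 2 := by
  have e : ∑ i : MarkKind × V, q i.1 * (g (heightStep i.1 i.2 h) - g h) ^ 2 =
      ∑ i : MarkKind × V, q i.1 * g (heightStep i.1 i.2 h) ^ 2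
      - 2 * g h * ∑ i : MarkKind × V, q i.1 * g (heightStep i.1 i.2 h)
      + g h ^ 2 * ∑ i : MarkKind × V, q i.1 := by
    rw [Finset.mul_sum, Finset.mul_sum, ← Finset.sum_sub_distrib, ← Finset.sum_add_distrib]
    exact Finset.sum_congr rfl fun i _ => by ring
  rw [e]
  simp only [transition, Pi.pow_apply]
  nlinarith [sq_nonneg (∑ i : MarkKind × V, q i.1 * g (heightStep i.1 i.2 h)
    - (∑ i : MarkKind × V, q i.1) * g h)]

/-- The sum over the cycle of the variances of the heights is at most the expected number of
marks. -/
lemma sum_variance_le (hq : IsStepWeight V q) (m : ℕ) (h : V → ℤ) :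
    ∑ y, ((transition q)^[m] (fun h => (h y : ℝ) ^ 2) h - meanHeight q m y h ^ 2) ≤
      m * ∑ i : MarkKind × V, q i.1 := by
  induction m generalizing h with
  | zero => simp [meanHeight]
  | succ m ih =>
    -- Law of total variance, conditioning on the first of the `m + 1` steps: `F` is the summed
    -- variance accumulated by the remaining `m` steps, and `h3` bounds the variance of their
    -- conditional means.
    set F : (V → ℤ) → ℝ := ∑ y, ((transition q)^[m] (fun h => (h y : ℝ) ^ 2)
      - meanHeight q m y ^ 2) with hF
    have hFle : F ≤ fun _ => m * ∑ i : MarkKind × V, q i.1 := by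
      intro h
      simpa [hF] using ih h
    have h1 := transition_le hq hFle h
    rw [transition_const] at h1
    have h2 : transition q F h = ∑ y, ((transition q)^[m + 1] (fun h => (h y : ℝ) ^ 2) h
        - transition q (meanHeight q m y ^ 2) h) := by
      change transitionLM q F h = _
      rw [hF, map_sum, Finset.sum_apply]
      refine Finset.sum_congr rfl fun y _ => ?_
      rw [map_sub, Function.iterate_succ_apply']
      rfl
    have h3 : ∑ y, (transition q (meanHeight q m y ^ 2) h - transition q (meanHeight q m y) h ^ 2)
        ≤ ∑ i : MarkKind × V, q i.1 := by
      refine (Finset.sum_le_sum fun y _ => transition_sq_sub_sq_le _ _).trans ?_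
      rw [Finset.sum_comm]
      refine Finset.sum_le_sum fun i _ => ?_
      rw [← Finset.mul_sum]
      exact mul_le_of_le_one_right (hq.nonneg _) (sum_sq_meanHeight_sub_le hq m i.1 i.2 h)
    have h4 : ∑ y, ((transition q)^[m + 1] (fun h => (h y : ℝ) ^ 2) h
        - meanHeight q (m + 1) y h ^ 2) = transition q F h +
        ∑ y, (transition q (meanHeight q m y ^ 2) h - transition q (meanHeight q m y) h ^ 2) := by
      rw [h2, ← Finset.sum_add_distrib]
      refine Finset.sum_congr rfl fun y _ => ?_
      rw [meanHeight_succ]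
      ring
    rw [h4]
    push_cast
    linarith

/-- Flat heights are invariant under translations of the cycle, so all edges have the same one-point
law. -/
lemma transition_iterate_eval_zero (f : ℤ → ℝ) (m : ℕ) (y : V) :
    (transition q)^[m] (fun h => f (h y)) 0 = (transition q)^[m] (fun h : V → ℤ => f (h 0)) 0 := by
  have h1 := congrFun (transition_iterate_shift (q := q) (fun h : V → ℤ => f (h 0)) y m) 0
  simp only [zero_add] at h1
  exact h1

/-- Starting from flat heights, the mean height at each edge grows linearly. -/
lemma meanHeight_flat (hq : IsStepWeight V q) (m : ℕ) (y : V) :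
    meanHeight q m y 0 = m * q .nucleation := by
  have hs := sum_meanHeight hq m 0
  have h0 : ∀ z, meanHeight q m z 0 = meanHeight q m y 0 := fun z =>
    (transition_iterate_eval_zero (fun n => (n : ℝ)) m z).trans
      (transition_iterate_eval_zero (fun n => (n : ℝ)) m y).symm
  simp only [h0, Finset.sum_const, Finset.card_univ, nsmul_eq_mul] at hs
  have hc : (Fintype.card V : ℝ) ≠ 0 := by
    exact_mod_cast Fintype.card_ne_zero (α := V)
  simp only [Pi.zero_apply, Finset.sum_const_zero, Int.cast_zero, zero_add] at hs
  exact mul_left_cancel₀ hc (by linarith)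

/-- The summands in `sum_variance_le` are all equal here, and dividing by the length of the cycle
leaves a bound independent of that length. -/
lemma variance_flat_le (hq : IsStepWeight V q) (m : ℕ) :
    (transition q)^[m] (fun h : V → ℤ => (h 0 : ℝ) ^ 2) 0 - (m * q .nucleation) ^ 2 ≤
      m * (4 * q .leftArrowR + q .nucleation) := by
  have hs := sum_variance_le hq m (0 : V → ℤ)
  have h0 : ∀ z : V, (transition q)^[m] (fun h : V → ℤ => (h z : ℝ) ^ 2) 0 =
      (transition q)^[m] (fun h : V → ℤ => (h 0 : ℝ) ^ 2) 0 :=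
    transition_iterate_eval_zero (fun n => (n : ℝ) ^ 2) m
  simp only [h0, meanHeight_flat hq, Finset.sum_const, Finset.card_univ, nsmul_eq_mul,
    sum_weights hq] at hs
  have hc : 0 < (Fintype.card V : ℝ) := by exact_mod_cast Fintype.card_pos (α := V)
  refine le_of_mul_le_mul_left ?_ hc
  linarith

/-- Chebyshev's inequality for the height of an edge after `m` steps. -/
lemma transition_iterate_indicator_le (hq : IsStepWeight V q) (m : ℕ) (c : ℝ) {a : ℝ}
    (ha : 0 < a) :
    (transition q)^[m] ({h : V → ℤ | a ≤ |(h 0 : ℝ) - c|}.indicator 1) 0 ≤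
      (m * (4 * q .leftArrowR + q .nucleation) + (m * q .nucleation - c) ^ 2) / a ^ 2 := by
  set f2 : (V → ℤ) → ℝ := fun h => (h 0 : ℝ) ^ 2 with hf2
  set f1 : (V → ℤ) → ℝ := fun h => (h 0 : ℝ) with hf1
  -- The Markov majorant `(h 0 - c) ^ 2 / a ^ 2` is written as a combination of `f2`, `f1` and a
  -- constant, so that linearity reduces its mean to the first two moments.
  have hle : ({h : V → ℤ | a ≤ |(h 0 : ℝ) - c|}.indicator 1 : (V → ℤ) → ℝ) ≤
      (a ^ 2)⁻¹ • (f2 + ((-2 * c) • f1 + fun _ => c ^ 2)) := by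
    intro h
    have e : ((a ^ 2)⁻¹ • (f2 + ((-2 * c) • f1 + fun _ => c ^ 2)) : (V → ℤ) → ℝ) h =
        ((h 0 : ℝ) - c) ^ 2 / a ^ 2 := by
      simp only [hf2, hf1, Pi.smul_apply, Pi.add_apply, smul_eq_mul]
      field_simp
      ring
    rw [e]
    refine Set.indicator_apply_le' (fun hh => ?_) (fun _ => by positivity)
    rw [Pi.one_apply, one_le_div (by positivity), ← sq_abs ((h 0 : ℝ) - c)]
    exact pow_le_pow_left₀ ha.le hh 2
  refine (transition_iterate_le hq hle m 0).trans ?_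
  rw [← transitionLM_pow, map_smul, map_add, map_add, map_smul, transitionLM_pow, transitionLM_pow,
    transitionLM_pow, transition_iterate_const]
  have hm : (transition q)^[m] f1 0 = m * q .nucleation := meanHeight_flat hq m 0
  have hv := variance_flat_le hq m
  rw [← hf2] at hv
  simp only [Pi.smul_apply, Pi.add_apply, smul_eq_mul, hm]
  rw [inv_mul_eq_div]
  refine div_le_div_of_nonneg_right ?_ (by positivity)
  linarith

end Chain

/-! ### Particles and heights -/

/-- The configuration `S`, reached after `c x` nucleations on each edge `x`, has heights `h`. -/
structure State.HasHeights (S : State) (c : ℤ → ℕ) (h : ℤ → ℤ) : Prop where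
  excl : ∀ x, S.left x = 0 ∨ S.right x = 0
  slope : ∀ x, (S.right x : ℤ) - S.left x = h (x - 1) - h x
  flow : ∀ x, (c x : ℤ) - S.flowL x + S.flowR x = h x

/-- Whether the particle settles or annihilates, the charge `right - left` at its site drops by one;
only this charge matters for the heights. -/
lemma State.addL_spec (S : State) (y : ℤ) (hS : ∀ x, S.left x = 0 ∨ S.right x = 0) :
    (∀ x, (S.addL y).left x = 0 ∨ (S.addL y).right x = 0) ∧
    (∀ x, ((S.addL y).right x : ℤ) - (S.addL y).left x =
      S.right x - S.left x - if x = y then 1 else 0) ∧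
    (S.addL y).flowL = S.flowL ∧ (S.addL y).flowR = S.flowR := by
  unfold State.addL
  split_ifs with h0
  · refine ⟨fun x => ?_, fun x => ?_, rfl, rfl⟩ <;> have := hS x <;>
      simp only [Function.update_apply] <;> split_ifs with hx <;> (try subst hx) <;> omega
  · refine ⟨fun x => ?_, fun x => ?_, rfl, rfl⟩ <;> have := hS x <;>
      simp only [Function.update_apply] <;> split_ifs with hx <;> (try subst hx) <;> omega

lemma State.addR_spec (S : State) (y : ℤ) (hS : ∀ x, S.left x = 0 ∨ S.right x = 0) :
    (∀ x, (S.addR y).left x = 0 ∨ (S.addR y).right x = 0) ∧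
    (∀ x, ((S.addR y).right x : ℤ) - (S.addR y).left x =
      S.right x - S.left x + if x = y then 1 else 0) ∧
    (S.addR y).flowL = S.flowL ∧ (S.addR y).flowR = S.flowR := by
  unfold State.addR
  split_ifs with h0
  · refine ⟨fun x => ?_, fun x => ?_, rfl, rfl⟩ <;> have := hS x <;>
      simp only [Function.update_apply] <;> split_ifs with hx <;> (try subst hx) <;> omega
  · refine ⟨fun x => ?_, fun x => ?_, rfl, rfl⟩ <;> have := hS x <;>
      simp only [Function.update_apply] <;> split_ifs with hx <;> (try subst hx) <;> omega

lemma State.jumpL_spec (S : State) (src dst e sgn : ℤ) (hS : ∀ x, S.left x = 0 ∨ S.right x = 0)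
    (h0 : 0 < S.left src) :
    (∀ x, (S.jumpL src dst e sgn).left x = 0 ∨ (S.jumpL src dst e sgn).right x = 0) ∧
    (∀ x, ((S.jumpL src dst e sgn).right x : ℤ) - (S.jumpL src dst e sgn).left x =
      S.right x - S.left x + (if x = src then 1 else 0) - if x = dst then 1 else 0) ∧
    (∀ x, (S.jumpL src dst e sgn).flowL x = S.flowL x + if x = e then sgn else 0) ∧
    (S.jumpL src dst e sgn).flowR = S.flowR := by
  unfold State.jumpL
  rw [if_pos h0]
  obtain ⟨h1, h2, h3, h4⟩ := State.addL_spec { S with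
      left := Function.update S.left src (S.left src - 1)
      flowL := Function.update S.flowL e (S.flowL e + sgn) } dst (fun x => by
        have := hS x
        simp only [Function.update_apply]
        split_ifs with hx <;> (try subst hx) <;> omega)
  refine ⟨h1, fun x => ?_, fun x => ?_, h4⟩
  · rw [h2]
    simp only [Function.update_apply]
    split_ifs with hx <;> (try subst hx) <;> omega
  · rw [h3]
    simp only [Function.update_apply]
    split_ifs with hx <;> (try subst hx) <;> omega

lemma State.jumpR_spec (S : State) (src dst e sgn : ℤ) (hS : ∀ x, S.left x = 0 ∨ S.right x = 0)
    (h0 : 0 < S.right src) :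
    (∀ x, (S.jumpR src dst e sgn).left x = 0 ∨ (S.jumpR src dst e sgn).right x = 0) ∧
    (∀ x, ((S.jumpR src dst e sgn).right x : ℤ) - (S.jumpR src dst e sgn).left x =
      S.right x - S.left x - (if x = src then 1 else 0) + if x = dst then 1 else 0) ∧
    (∀ x, (S.jumpR src dst e sgn).flowR x = S.flowR x + if x = e then sgn else 0) ∧
    (S.jumpR src dst e sgn).flowL = S.flowL := by
  unfold State.jumpR
  rw [if_pos h0]
  obtain ⟨h1, h2, h3, h4⟩ := State.addR_spec { S with
      right := Function.update S.right src (S.right src - 1)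
      flowR := Function.update S.flowR e (S.flowR e + sgn) } dst (fun x => by
        have := hS x
        simp only [Function.update_apply]
        split_ifs with hx <;> (try subst hx) <;> omega)
  refine ⟨h1, fun x => ?_, fun x => ?_, h3⟩
  · rw [h2]
    simp only [Function.update_apply]
    split_ifs with hx <;> (try subst hx) <;> omega
  · rw [h4]
    simp only [Function.update_apply]
    split_ifs with hx <;> (try subst hx) <;> omega

/-- By exclusion and `slope`, a particle able to use an arrow exists exactly when the comparison in
`growth` holds. A jump or nucleation then shifts charge across the single edge `e`, which is the
gradient of a unit change of the height at `e`. -/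
lemma State.HasHeights.act {S : State} {c : ℤ → ℕ} {h : ℤ → ℤ} (H : S.HasHeights c h)
    (k : MarkKind) (e : ℤ) :
    (S.act k e).HasHeights (fun x => c x + if k = .nucleation ∧ e = x then 1 else 0)
      (heightStep k e h) := by
  have hz : ∀ x : ℤ, x + 1 - 1 = x := fun x => by ring
  cases k
  case leftArrowR =>
    have hs := H.slope (e + 1)
    have hx := H.excl (e + 1)
    rw [hz] at hs
    simp only [State.act]
    by_cases h0 : 0 < S.right (e + 1)
    · have hg : growth .leftArrowR e h = -1 := by simp only [growth]; rw [if_pos (by omega)]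
      obtain ⟨h1, h2, h3, h4⟩ := State.jumpR_spec S (e + 1) e e (-1) H.excl h0
      refine ⟨h1, fun x => ?_, fun x => ?_⟩
      · have := H.slope x
        rw [h2, heightStep_apply, heightStep_apply, hg]
        split_ifs <;> omega
      · have := H.flow x
        rw [h3, h4, heightStep_apply, hg]
        simp only [reduceCtorEq, false_and, if_false, add_zero]
        split_ifs <;> omega
    · have hg : growth .leftArrowR e h = 0 := by simp only [growth]; rw [if_neg (by omega)]
      rw [State.jumpR, if_neg h0]
      simpa [heightStep, hg] using H
  case leftArrowL =>
    have hs := H.slope (e + 1)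
    have hx := H.excl (e + 1)
    rw [hz] at hs
    simp only [State.act]
    by_cases h0 : 0 < S.left (e + 1)
    · have hg : growth .leftArrowL e h = 1 := by simp only [growth]; rw [if_pos (by omega)]
      obtain ⟨h1, h2, h3, h4⟩ := State.jumpL_spec S (e + 1) e e (-1) H.excl h0
      refine ⟨h1, fun x => ?_, fun x => ?_⟩
      · have := H.slope x
        rw [h2, heightStep_apply, heightStep_apply, hg]
        split_ifs <;> omega
      · have := H.flow x
        rw [h3, h4, heightStep_apply, hg]
        simp only [reduceCtorEq, false_and, if_false, add_zero]
        split_ifs <;> omega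
    · have hg : growth .leftArrowL e h = 0 := by simp only [growth]; rw [if_neg (by omega)]
      rw [State.jumpL, if_neg h0]
      simpa [heightStep, hg] using H
  case rightArrowR =>
    have hs := H.slope e
    have hx := H.excl e
    simp only [State.act]
    by_cases h0 : 0 < S.right e
    · have hg : growth .rightArrowR e h = 1 := by simp only [growth]; rw [if_pos (by omega)]
      obtain ⟨h1, h2, h3, h4⟩ := State.jumpR_spec S e (e + 1) e 1 H.excl h0
      refine ⟨h1, fun x => ?_, fun x => ?_⟩
      · have := H.slope x
        rw [h2, heightStep_apply, heightStep_apply, hg]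
        split_ifs <;> omega
      · have := H.flow x
        rw [h3, h4, heightStep_apply, hg]
        simp only [reduceCtorEq, false_and, if_false, add_zero]
        split_ifs <;> omega
    · have hg : growth .rightArrowR e h = 0 := by simp only [growth]; rw [if_neg (by omega)]
      rw [State.jumpR, if_neg h0]
      simpa [heightStep, hg] using H
  case rightArrowL =>
    have hs := H.slope e
    have hx := H.excl e
    simp only [State.act]
    by_cases h0 : 0 < S.left e
    · have hg : growth .rightArrowL e h = -1 := by simp only [growth]; rw [if_pos (by omega)]
      obtain ⟨h1, h2, h3, h4⟩ := State.jumpL_spec S e (e + 1) e 1 H.excl h0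
      refine ⟨h1, fun x => ?_, fun x => ?_⟩
      · have := H.slope x
        rw [h2, heightStep_apply, heightStep_apply, hg]
        split_ifs <;> omega
      · have := H.flow x
        rw [h3, h4, heightStep_apply, hg]
        simp only [reduceCtorEq, false_and, if_false, add_zero]
        split_ifs <;> omega
    · have hg : growth .rightArrowL e h = 0 := by simp only [growth]; rw [if_neg (by omega)]
      rw [State.jumpL, if_neg h0]
      simpa [heightStep, hg] using H
  case nucleation =>
    simp only [State.act]
    obtain ⟨h1, h2, h3, h4⟩ := State.addL_spec S e H.excl
    obtain ⟨h5, h6, h7, h8⟩ := State.addR_spec (S.addL e) (e + 1) h1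
    refine ⟨h5, fun x => ?_, fun x => ?_⟩
    · have := H.slope x
      rw [h6, h2, heightStep_apply, heightStep_apply]
      simp only [growth]
      split_ifs <;> omega
    · have := H.flow x
      rw [h7, h8, h3, h4, heightStep_apply]
      simp only [growth, true_and]
      split_ifs <;> omega

/-- The heights obtained from `h` by applying the marks of the list `l` one after the other; the
edges of `ℤ` are projected to the set `V` of edges. -/
def runHeights {V : Type*} [CommRing V] [DecidableEq V] (l : List Mark) (h : V → ℤ) : V → ℤ :=
  l.foldl (fun h m => heightStep m.kind (m.edge : V) h) h

lemma hasHeights_foldl (l : List Mark) {S : State} {c : ℤ → ℕ} {h : ℤ → ℤ}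
    (H : S.HasHeights c h) :
    (l.foldl (fun S m => S.act m.kind m.edge) S).HasHeights
      (fun x => c x + l.countP fun m => m.kind = .nucleation ∧ m.edge = x) (runHeights l h) := by
  induction l generalizing S c h with
  | nil => simpa [runHeights] using H
  | cons m l ih =>
    have h1 := ih (H.act m.kind m.edge)
    rw [List.foldl_cons]
    convert h1 using 1
    · ext x
      rw [List.countP_cons]
      simp only [decide_eq_true_eq]
      omega
    · simp [runHeights]

lemma hasHeights_blockState (N : MarkKind → ℤ → ℝ≥0 → ℕ) (a b : ℤ) (t : ℝ≥0) :
    (blockState N a b t).HasHeights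
      (fun x => (blockList N a b t).countP fun m => m.kind = .nucleation ∧ m.edge = x)
      (runHeights (blockList N a b t) 0) := by
  have h0 : State.empty.HasHeights 0 0 := ⟨by simp [State.empty], by simp [State.empty],
    by simp [State.empty]⟩
  simpa [blockState] using hasHeights_foldl (blockList N a b t) h0

/-! ### Running a list of marks, and locality of the evolution -/

section Run

variable {V : Type*} [CommRing V] [DecidableEq V]

lemma runHeights_append (l l' : List Mark) (h : V → ℤ) :
    runHeights (l ++ l') h = runHeights l' (runHeights l h) :=
  List.foldl_append

lemma abs_runHeights_sub_le (l : List Mark) (h : ℤ → ℤ) (x : ℤ) :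
    |runHeights l h x - h x| ≤ l.countP fun m => m.edge = x := by
  induction l generalizing h with
  | nil => simp [runHeights]
  | cons m l ih =>
    have h1 := ih (heightStep m.kind m.edge h)
    have h2 := abs_heightStep_sub_le m.kind m.edge x h
    have h3 : runHeights (m :: l) h = runHeights l (heightStep m.kind m.edge h) := rfl
    rw [h3, List.countP_cons]
    have h4 := abs_sub_le (runHeights l (heightStep m.kind m.edge h) x)
      (heightStep m.kind m.edge h x) (h x)
    simp only [decide_eq_true_eq]
    push_cast
    linarith

/-- Marks outside a block delimited by two unmarked edges have no influence on the block. -/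
lemma runHeights_eq_runHeights_filter {W : Set ℤ} (hW : Set.InjOn (Int.cast : ℤ → V) W) {a b : ℤ}
    (hab : Set.Icc a b ⊆ W) (l : List Mark) (hl : ∀ m ∈ l, m.edge ∈ W)
    (hl' : ∀ m ∈ l, m.edge ≠ a ∧ m.edge ≠ b) (g : V → ℤ) (h : ℤ → ℤ)
    (hgh : ∀ x ∈ Set.Icc a b, g x = h x) :
    ∀ x ∈ Set.Icc a b,
      runHeights l g x = runHeights (l.filter fun m => a < m.edge ∧ m.edge < b) h x := by
  induction l generalizing g h with
  | nil => simpa [runHeights] using hgh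
  | cons m l ih =>
    have hm := hl m (by simp)
    have hm' := hl' m (by simp)
    have hr : ∀ x ∈ Set.Icc a b, (x : V) = m.edge ↔ x = m.edge := fun x hx =>
      ⟨fun he => hW (hab hx) hm he, fun he => by rw [he]⟩
    by_cases hin : a < m.edge ∧ m.edge < b
    · rw [List.filter_cons_of_pos (by simpa using hin)]
      refine ih (fun m' h' => hl m' (by simp [h'])) (fun m' h' => hl' m' (by simp [h']))
        (heightStep m.kind (m.edge : V) g) (heightStep m.kind m.edge h) fun x hx => ?_
      have hg : growth m.kind (m.edge : V) g = growth m.kind m.edge h := by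
        -- A mark strictly inside the block reads only heights of edges in `Icc a b`, where the two
        -- configurations agree.
        have e0 := hgh m.edge ⟨by omega, by omega⟩
        have e1 := hgh (m.edge + 1) ⟨by omega, by omega⟩
        have e2 := hgh (m.edge - 1) ⟨by omega, by omega⟩
        push_cast at e1 e2
        cases m.kind <;> simp only [growth, e0, e1, e2]
      simp only [heightStep_apply, hg, hgh x hx, hr x hx]
    · rw [List.filter_cons_of_neg (by simpa using hin)]
      refine ih (fun m' h' => hl m' (by simp [h'])) (fun m' h' => hl' m' (by simp [h']))
        (heightStep m.kind (m.edge : V) g) h fun x hx => ?_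
      have hne : x ≠ m.edge := by
        rintro rfl
        exact hin ⟨lt_of_le_of_ne hx.1 hm'.1.symm, lt_of_le_of_ne hx.2 hm'.2⟩
      rw [heightStep_apply, if_neg (by rwa [hr x hx]), add_zero, hgh x hx]

end Run

/-! ### Environments in which the process is well defined -/

/-- The properties of the environment that hold almost surely and make the process well defined:
the counting functions are those of locally finite sets of marks, no two marks occur at the same
time, and up to any time there are edges without marks on both sides. -/
structure GoodEnv (N : MarkKind → ℤ → ℝ≥0 → ℕ) : Prop where
  zero : ∀ k x, N k x 0 = 0
  mono : ∀ k x, Monotone (N k x)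
  rightCont : ∀ k x t, ContinuousWithinAt (N k x) (Set.Ici t) t
  simple : ∀ k x u, 0 < u → ∃ s < u, N k x u ≤ N k x s + 1
  time_inj : ∀ m m' : Mark, m.Occurs N → m'.Occurs N → m.time = m'.time → m = m'
  isolated : ∀ t, ∃ p, Isolates N 0 t p

/-- The jump time is the infimum of the times at which level `v` is reached. An integer-valued
right-continuous function is constant just after each time, so the infimum is attained. -/
lemma exists_jump {f : ℝ≥0 → ℕ} (hm : Monotone f)
    (hc : ∀ t, ContinuousWithinAt f (Set.Ici t) t) {s t : ℝ≥0} {v : ℕ} (hs : f s < v)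
    (ht : v ≤ f t) : ∃ u, s < u ∧ u ≤ t ∧ v ≤ f u ∧ ∀ r < u, f r < v := by
  set A : Set ℝ≥0 := {u | v ≤ f u} with hA
  have hne : A.Nonempty := ⟨t, ht⟩
  have hmem : v ≤ f (sInf A) := by
    by_contra! hlt
    have hev : ∀ᶠ r in 𝓝[≥] (sInf A), f r = f (sInf A) := by
      have hd : ∀ᶠ n in 𝓝 (f (sInf A)), n = f (sInf A) := by simp
      exact (hc (sInf A)).eventually hd
    obtain ⟨w, hw, hsub⟩ := mem_nhdsGE_iff_exists_Ico_subset.1 hev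
    obtain ⟨r, hr, hrw⟩ := exists_lt_of_csInf_lt hne hw
    have h1 : f r = f (sInf A) := hsub ⟨csInf_le' hr, hrw⟩
    have h2 : v ≤ f r := hr
    omega
  have hlt : ∀ r < sInf A, f r < v := fun r hr => not_le.1 fun h => notMem_of_lt_csInf' hr h
  refine ⟨sInf A, ?_, csInf_le' ht, hmem, hlt⟩
  by_contra! hle
  have := hm hle
  omega

section Env

variable {N : MarkKind → ℤ → ℝ≥0 → ℕ}

lemma unmarked_of_eq_zero (hm : ∀ k x, Monotone (N k x)) {t : ℝ≥0} {x : ℤ}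
    (h : ∀ k, N k x t = 0) : Unmarked N t x := by
  rintro m ⟨hpos, hlt⟩ rfl
  by_contra! hle
  have h1 := hm m.kind m.edge hle
  have h2 := hlt 0 hpos
  have h3 := h m.kind
  omega

/-- A counting function is strictly larger at a mark than before it, so a mark is determined by its
kind, its edge and the count at its time; these take finitely many values. -/
lemma blockMarks_finite (hm : ∀ k x, Monotone (N k x)) (a b : ℤ) (t : ℝ≥0) :
    (blockMarks N a b t).Finite := by
  set B : Set (MarkKind × ℤ × ℕ) :=
    ⋃ k : MarkKind, ⋃ x ∈ Set.Ioo a b, (fun n => (k, x, n)) '' Set.Iic (N k x t) with hB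
  have hBf : B.Finite := Set.finite_iUnion fun k =>
    (Set.finite_Ioo a b).biUnion fun x _ => (Set.finite_Iic _).image _
  refine Set.Finite.of_finite_image (f := fun m : Mark => (m.kind, m.edge, N m.kind m.edge m.time))
    (hBf.subset ?_) ?_
  · rintro _ ⟨m, ⟨_, ht, ha, hb⟩, rfl⟩
    simp only [hB, Set.mem_iUnion]
    exact ⟨m.kind, m.edge, ⟨ha, hb⟩, _, hm _ _ ht, rfl⟩
  · rintro ⟨u, k, x⟩ ⟨⟨_, h1⟩, -⟩ ⟨u', k', x'⟩ ⟨⟨_, h1'⟩, -⟩ he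
    simp only [Prod.mk.injEq] at he
    obtain ⟨rfl, rfl, he⟩ := he
    rcases lt_trichotomy u u' with hlt | rfl | hlt
    · have := h1' u hlt
      simp only at this
      omega
    · rfl
    · have := h1 u' hlt
      simp only at this
      omega

lemma mem_blockList (hm : ∀ k x, Monotone (N k x)) {a b : ℤ} {t : ℝ≥0} {m : Mark} :
    m ∈ blockList N a b t ↔ m.Occurs N ∧ m.time ≤ t ∧ a < m.edge ∧ m.edge < b := by
  rw [blockList, dif_pos (blockMarks_finite hm a b t), List.mem_insertionSort]
  simp [blockMarks]

lemma blockList_nodup (hm : ∀ k x, Monotone (N k x)) (a b : ℤ) (t : ℝ≥0) :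
    (blockList N a b t).Nodup := by
  rw [blockList, dif_pos (blockMarks_finite hm a b t)]
  exact (List.perm_insertionSort _ _).nodup_iff.2 (Finset.nodup_toList _)

lemma GoodEnv.blockList_pairwise (hN : GoodEnv N) (a b : ℤ) (t : ℝ≥0) :
    (blockList N a b t).Pairwise fun m m' => m.time < m'.time := by
  have h1 : (blockList N a b t).Pairwise fun m m' => m.time ≤ m'.time := by
    rw [blockList, dif_pos (blockMarks_finite hN.mono a b t)]
    have : Std.Total fun m m' : Mark => m.time ≤ m'.time := ⟨fun m m' => le_total _ _⟩
    have : IsTrans Mark fun m m' : Mark => m.time ≤ m'.time := ⟨fun _ _ _ => le_trans⟩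
    exact List.pairwise_insertionSort _ _
  refine List.Pairwise.imp_of_mem ?_ (h1.and (blockList_nodup hN.mono a b t))
  intro m m' hm hm' ⟨hle, hne⟩
  refine lt_of_le_of_ne hle fun he => hne ?_
  exact hN.time_inj m m' ((mem_blockList hN.mono).1 hm).1 ((mem_blockList hN.mono).1 hm').1 he

lemma eq_of_pairwise_time_lt {l l' : List Mark} (hl : l.Pairwise fun m m' => m.time < m'.time)
    (hl' : l'.Pairwise fun m m' => m.time < m'.time) (h : ∀ m, m ∈ l ↔ m ∈ l') : l = l' := by
  have hn : ∀ {l : List Mark}, (l.Pairwise fun m m' => m.time < m'.time) → l.Nodup := fun hl =>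
    hl.imp fun hlt he => by rw [he] at hlt; exact lt_irrefl _ hlt
  exact List.Perm.eq_of_pairwise (fun a b _ _ h1 h2 => absurd h1 h2.asymm) hl hl'
    ((List.perm_ext_iff_of_nodup (hn hl) (hn hl')).2 h)

lemma GoodEnv.blockList_filter (hN : GoodEnv N) {a b a' b' : ℤ} (ha : a ≤ a') (hb : b' ≤ b)
    (t : ℝ≥0) :
    (blockList N a b t).filter (fun m => a' < m.edge ∧ m.edge < b') = blockList N a' b' t := by
  refine eq_of_pairwise_time_lt ((hN.blockList_pairwise a b t).filter _)
    (hN.blockList_pairwise a' b' t) fun m => ?_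
  simp only [List.mem_filter, mem_blockList hN.mono, decide_eq_true_eq]
  constructor
  · rintro ⟨⟨h1, h2, -, -⟩, h3, h4⟩
    exact ⟨h1, h2, h3, h4⟩
  · rintro ⟨h1, h2, h3, h4⟩
    exact ⟨⟨h1, h2, by omega, by omega⟩, h3, h4⟩

lemma GoodEnv.blockList_append (hN : GoodEnv N) (a b : ℤ) {s t : ℝ≥0} (hst : s ≤ t) {r : List Mark}
    (hr : r.Pairwise fun m m' => m.time < m'.time)
    (hmem : ∀ m, m ∈ r ↔ m ∈ blockList N a b t ∧ s < m.time) :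
    blockList N a b t = blockList N a b s ++ r := by
  refine eq_of_pairwise_time_lt (hN.blockList_pairwise a b t) (List.pairwise_append.2
    ⟨hN.blockList_pairwise a b s, hr, fun m hm m' hm' => ?_⟩) fun m => ?_
  · exact ((mem_blockList hN.mono).1 hm).2.1.trans_lt ((hmem m').1 hm').2
  · rw [List.mem_append, hmem, mem_blockList hN.mono, mem_blockList hN.mono]
    constructor
    · rintro ⟨h1, h2, h3⟩
      rcases le_or_gt m.time s with h | h
      · exact Or.inl ⟨h1, h, h3⟩
      · exact Or.inr ⟨⟨h1, h2, h3⟩, h⟩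
    · rintro (⟨h1, h2, h3⟩ | ⟨h, -⟩)
      · exact ⟨h1, h2.trans hst, h3⟩
      · exact h

/-- Sending a mark to the count at its time is a bijection onto the levels `1, …, N k x t`.
Surjectivity needs unit jumps (`simple`): no level is skipped. -/
lemma GoodEnv.countP_blockList (hN : GoodEnv N) {a b x : ℤ} (ha : a < x) (hb : x < b)
    (k : MarkKind) (t : ℝ≥0) :
    (blockList N a b t).countP (fun m => m.kind = k ∧ m.edge = x) = N k x t := by
  classical
  rw [List.countP_eq_length_filter,
    ← List.toFinset_card_of_nodup ((blockList_nodup hN.mono a b t).filter _)]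
  rw [show N k x t = (Finset.Icc 1 (N k x t)).card by simp]
  refine Finset.card_nbij (fun m => N k x m.time) ?_ ?_ ?_
  · intro m hm
    simp only [List.coe_toFinset, Set.mem_ofPred_eq, List.mem_filter, mem_blockList hN.mono,
      decide_eq_true_eq] at hm
    obtain ⟨⟨⟨h1, h2⟩, h3, -⟩, rfl, rfl⟩ := hm
    have := h2 0 h1
    simp only [Finset.coe_Icc, Set.mem_Icc]
    exact ⟨by omega, hN.mono _ _ h3⟩
  · intro m hm m' hm' he
    simp only [List.coe_toFinset, Set.mem_ofPred_eq, List.mem_filter, mem_blockList hN.mono,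
      decide_eq_true_eq] at hm hm'
    obtain ⟨⟨⟨h1, h2⟩, h3, -⟩, rfl, rfl⟩ := hm
    obtain ⟨⟨⟨h1', h2'⟩, h3', -⟩, hk, hx⟩ := hm'
    rw [hk, hx] at h2'
    simp only at he
    refine hN.time_inj m m' ⟨h1, h2⟩ ⟨h1', by rwa [hk, hx]⟩ ?_
    rcases lt_trichotomy m.time m'.time with hlt | heq | hlt
    · have := h2' _ hlt
      omega
    · exact heq
    · have := h2 _ hlt
      omega
  · intro v hv
    simp only [Finset.coe_Icc, Set.mem_Icc] at hv
    obtain ⟨u, hu0, hut, hvu, hlt⟩ := exists_jump (hN.mono k x) (hN.rightCont k x)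
      (s := 0) (v := v) (by rw [hN.zero]; omega) hv.2
    obtain ⟨s, hs, hle⟩ := hN.simple k x u hu0
    have h1 := hlt s hs
    refine ⟨⟨u, k, x⟩, ?_, by simp only; omega⟩
    simp only [List.coe_toFinset, Set.mem_ofPred_eq, List.mem_filter, mem_blockList hN.mono,
      decide_eq_true_eq, and_self, and_true]
    exact ⟨⟨hu0, fun r hr => (hlt r hr).trans_le hvu⟩, hut, ha, hb⟩

lemma countP_edge_eq_sum (l : List Mark) (x : ℤ) :
    l.countP (fun m => m.edge = x) = ∑ k, l.countP fun m => m.kind = k ∧ m.edge = x := by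
  induction l with
  | nil => simp
  | cons m l ih =>
    simp only [List.countP_cons, ih, Finset.sum_add_distrib, decide_eq_true_eq]
    congr 1
    by_cases hx : m.edge = x <;> simp [hx]

/-- The heights in a block between unmarked edges do not depend on the surroundings. -/
lemma GoodEnv.runHeights_block (hN : GoodEnv N) {V : Type*} [CommRing V] [DecidableEq V]
    {W : Set ℤ} (hW : Set.InjOn (Int.cast : ℤ → V) W) {a b a' b' : ℤ} {t : ℝ≥0}
    (hab : Set.Ioo a b ⊆ W) (hab' : Set.Icc a' b' ⊆ W) (ha : a ≤ a') (hb : b' ≤ b)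
    (ha' : Unmarked N t a') (hb' : Unmarked N t b') {x : ℤ} (hx : x ∈ Set.Icc a' b') :
    runHeights (blockList N a b t) (0 : V → ℤ) x = runHeights (blockList N a' b' t) (0 : ℤ → ℤ) x := by
  rw [← hN.blockList_filter ha hb]
  refine runHeights_eq_runHeights_filter hW hab' _ (fun m hm => ?_) (fun m hm => ?_) 0 0
    (by simp) x hx
  · exact hab ((mem_blockList hN.mono).1 hm).2.2
  · obtain ⟨h1, h2, -⟩ := (mem_blockList hN.mono).1 hm
    exact ⟨fun he => (ha' m h1 he).not_ge h2, fun he => (hb' m h1 he).not_ge h2⟩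

lemma GoodEnv.height_eq (hN : GoodEnv N) {t : ℝ≥0} {p : ℤ × ℤ} (hp : Isolates N 0 t p) :
    height N 0 t = runHeights (blockList N p.1 p.2 t) (0 : ℤ → ℤ) 0 := by
  have hex : ∃ p, Isolates N 0 t p := ⟨p, hp⟩
  rw [height, dif_pos hex]
  have hc := hex.choose_spec
  set c := hex.choose
  have hflow := (hasHeights_blockState N c.1 c.2 t).flow 0
  rw [hN.countP_blockList hc.1 hc.2.1] at hflow
  rw [hflow]
  -- The arbitrarily chosen block and the given one are both compared with their intersection, whose
  -- boundary edges are also unmarked.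
  have key : ∀ p' : ℤ × ℤ, Isolates N 0 t p' → max c.1 p.1 ≥ p'.1 → min c.2 p.2 ≤ p'.2 →
      runHeights (blockList N p'.1 p'.2 t) (0 : ℤ → ℤ) 0 =
        runHeights (blockList N (max c.1 p.1) (min c.2 p.2) t) (0 : ℤ → ℤ) 0 := by
    intro p' _ h1 h2
    refine hN.runHeights_block (V := ℤ) (W := Set.univ) (x := 0) (fun _ _ _ _ h => by simpa using h)
      (Set.subset_univ _) (Set.subset_univ _) h1 h2 ?_ ?_ ?_
    · rcases max_choice c.1 p.1 with h | h <;> rw [h]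
      exacts [hc.2.2.1, hp.2.2.1]
    · rcases min_choice c.2 p.2 with h | h <;> rw [h]
      exacts [hc.2.2.2, hp.2.2.2]
    · exact ⟨(max_lt hc.1 hp.1).le, (lt_min hc.2.1 hp.2.1).le⟩
  rw [key c hc (le_max_left _ _) (min_le_left _ _), key p hp (le_max_right _ _) (min_le_right _ _)]

lemma Isolates.anti {s t : ℝ≥0} (hst : s ≤ t) {x : ℤ} {p : ℤ × ℤ} (hp : Isolates N x t p) :
    Isolates N x s p :=
  ⟨hp.1, hp.2.1, fun m hm he => hst.trans_lt (hp.2.2.1 m hm he),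
    fun m hm he => hst.trans_lt (hp.2.2.2 m hm he)⟩

/-- The height of an edge changes at most as often as marks occur on it. -/
lemma GoodEnv.abs_height_sub_le (hN : GoodEnv N) {s t : ℝ≥0} (hst : s ≤ t) :
    |height N 0 t - height N 0 s| ≤ ∑ k, ((N k 0 t : ℤ) - N k 0 s) := by
  obtain ⟨p, hp⟩ := hN.isolated t
  rw [hN.height_eq hp, hN.height_eq (hp.anti hst)]
  have happ := hN.blockList_append p.1 p.2 hst
    (r := (blockList N p.1 p.2 t).filter fun m => s < m.time)
    ((hN.blockList_pairwise p.1 p.2 t).filter _) (by simp [List.mem_filter])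
  have hc := congrArg (List.countP fun m => m.edge = (0 : ℤ)) happ
  rw [List.countP_append, countP_edge_eq_sum, countP_edge_eq_sum (blockList N p.1 p.2 s)] at hc
  simp only [hN.countP_blockList hp.1 hp.2.1] at hc
  rw [happ, runHeights_append]
  refine (abs_runHeights_sub_le _ _ 0).trans ?_
  rw [Finset.sum_sub_distrib]
  have h2 := congrArg (Nat.cast : ℕ → ℤ) hc
  push_cast at h2
  linarith

end Env

/-! ### The chain driven by a sequence of marks -/

section ChainHeight

variable {V : Type*} [CommRing V] [DecidableEq V]

/-- The action of a mark, or of no mark. -/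
def optStep (h : V → ℤ) (o : Option (MarkKind × V)) : V → ℤ :=
  o.elim h fun i => heightStep i.1 i.2 h

/-- The heights after the steps `w 0, w 1, …`, starting from flat heights. -/
def chainHeight {m : ℕ} (w : Fin m → Option (MarkKind × V)) : V → ℤ :=
  (List.ofFn w).foldl optStep 0

lemma chainHeight_succ {m : ℕ} (w : Fin (m + 1) → Option (MarkKind × V)) :
    chainHeight w = optStep (chainHeight fun j : Fin m => w j.castSucc) (w (Fin.last m)) := by
  rw [chainHeight, List.ofFn_succ', List.concat_eq_append, List.foldl_append]
  rfl

variable [Fintype V]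

/-- The probability of each possible step of the chain. -/
def stepProb (q : MarkKind → ℝ) (o : Option (MarkKind × V)) : ℝ :=
  o.elim (1 - ∑ i : MarkKind × V, q i.1) fun i => q i.1

lemma transition_eq_sum (q : MarkKind → ℝ) (g : (V → ℤ) → ℝ) (h : V → ℤ) :
    transition q g h = ∑ o, stepProb q o * g (optStep h o) := by
  rw [Fintype.sum_option]
  rfl

/-- Identifies iterates of the operator with expectations over independent steps; the induction
splits off the last step. -/
lemma sum_prod_stepProb_mul (q : MarkKind → ℝ) (m : ℕ) (g : (V → ℤ) → ℝ) :
    ∑ w : Fin m → Option (MarkKind × V), (∏ j, stepProb q (w j)) * g (chainHeight w) =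
      (transition q)^[m] g 0 := by
  induction m generalizing g with
  | zero => simp [chainHeight]
  | succ m ih =>
    rw [Function.iterate_succ_apply, ← ih (transition q g),
      ← Equiv.sum_comp (Fin.snocEquiv fun _ : Fin (m + 1) => Option (MarkKind × V)),
      Fintype.sum_prod_type, Finset.sum_comm]
    refine Finset.sum_congr rfl fun w _ => ?_
    rw [transition_eq_sum, Finset.mul_sum]
    refine Finset.sum_congr rfl fun o _ => ?_
    rw [chainHeight_succ, Fin.prod_univ_castSucc]
    simp [Fin.snocEquiv, mul_assoc]

end ChainHeight

/-! ### Discretization of time -/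

open Classical in
/-- The unique mark counted by `ξ`, if `ξ` counts exactly one mark. -/
def uniqueMark {ι : Type*} [DecidableEq ι] (ξ : ι → ℕ) : Option ι :=
  if h : ∃ i, ξ = Pi.single i 1 then some h.choose else none

lemma uniqueMark_eq_some {ι : Type*} [DecidableEq ι] {ξ : ι → ℕ} {i : ι} :
    uniqueMark ξ = some i ↔ ξ = Pi.single i 1 := by
  unfold uniqueMark
  split_ifs with h
  · have hs := h.choose_spec
    rw [Option.some_inj]
    constructor
    · intro he
      rwa [he] at hs
    · intro he
      have h1 := congrFun (hs.symm.trans he) i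
      by_contra hne
      rw [Pi.single_eq_same, Pi.single_eq_of_ne (Ne.symm hne)] at h1
      exact zero_ne_one h1
  · simp only [false_iff]
    exact fun he => h ⟨i, he⟩

lemma uniqueMark_zero {ι : Type*} [DecidableEq ι] : uniqueMark (0 : ι → ℕ) = none := by
  rw [Option.eq_none_iff_forall_ne_some]
  intro i hi
  have := congrFun (uniqueMark_eq_some.1 hi) i
  simp at this

/-- The numbers of marks in `(s, t]` on the edges `-L, …, L`, which are identified with the cycle of
length `2 L + 1`. -/
def increments (N : MarkKind → ℤ → ℝ≥0 → ℕ) (L : ℕ) (s t : ℝ≥0)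
    (i : MarkKind × ZMod (2 * L + 1)) : ℕ :=
  N i.1 i.2.valMinAbs t - N i.1 i.2.valMinAbs s

/-- `ξ` counts at most one mark. -/
def AtMostOne {ι : Type*} [DecidableEq ι] (ξ : ι → ℕ) : Prop := ξ = 0 ∨ uniqueMark ξ ≠ none

lemma valMinAbs_mem_Icc (L : ℕ) (x : ZMod (2 * L + 1)) :
    x.valMinAbs ∈ Set.Icc (-(L : ℤ)) L := by
  have := x.valMinAbs_mem_Ioc
  simp only [Set.mem_Ioc] at this
  push_cast at this
  exact ⟨by omega, by omega⟩

lemma valMinAbs_intCast (L : ℕ) {e : ℤ} (he : e ∈ Set.Icc (-(L : ℤ)) L) :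
    ((e : ZMod (2 * L + 1))).valMinAbs = e := by
  rw [ZMod.valMinAbs_spec]
  refine ⟨rfl, ?_⟩
  obtain ⟨h1, h2⟩ := he
  simp only [Set.mem_Ioc]
  push_cast
  exact ⟨by omega, by omega⟩

lemma injOn_intCast_zmod (L : ℕ) :
    Set.InjOn (Int.cast : ℤ → ZMod (2 * L + 1)) (Set.Icc (-(L : ℤ)) L) := fun x hx y hy h => by
  rw [← valMinAbs_intCast L hx, ← valMinAbs_intCast L hy, h]

/-! ### Comparison of the height with the discrete chain on a cycle -/

section Mesh

variable {N : MarkKind → ℤ → ℝ≥0 → ℕ}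

lemma Mark.Occurs.increments_pos (hm : ∀ k x, Monotone (N k x)) {L : ℕ} {m : Mark}
    (h : m.Occurs N) (he : m.edge ∈ Set.Icc (-(L : ℤ)) L) {s t : ℝ≥0} (hs : s < m.time)
    (ht : m.time ≤ t) : 0 < increments N L s t (m.kind, m.edge) := by
  have h1 := h.2 s hs
  have h2 := hm m.kind m.edge ht
  simp only [increments, valMinAbs_intCast L he]
  omega

/-- With at most one mark in `(s, t]`, the increments of the counting functions determine the marks
up to their exact time, and the dynamics ignores that time. -/
lemma GoodEnv.runHeights_step (hN : GoodEnv N) (L : ℕ) {s t : ℝ≥0} (hst : s ≤ t)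
    (h : AtMostOne (increments N L s t)) :
    runHeights (blockList N (-L - 1) (L + 1) t) (0 : ZMod (2 * L + 1) → ℤ) =
      optStep (runHeights (blockList N (-L - 1) (L + 1) s) 0) (uniqueMark (increments N L s t)) := by
  have hmem : ∀ m ∈ blockList N (-L - 1) (L + 1) t, s < m.time →
      m.edge ∈ Set.Icc (-(L : ℤ)) L ∧ 0 < increments N L s t (m.kind, m.edge) := by
    intro m hm hs
    obtain ⟨h1, h2, h3, h4⟩ := (mem_blockList hN.mono).1 hm
    have he : m.edge ∈ Set.Icc (-(L : ℤ)) L := ⟨by omega, by omega⟩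
    exact ⟨he, h1.increments_pos hN.mono he hs h2⟩
  rcases h with h0 | h1
  · rw [h0, uniqueMark_zero]
    have := hN.blockList_append (-L - 1) (L + 1) hst (r := []) List.Pairwise.nil fun m => by
      simp only [List.not_mem_nil, false_iff, not_and]
      intro hm hs
      have := (hmem m hm hs).2
      simp [h0] at this
    rw [this, List.append_nil]
    rfl
  · obtain ⟨⟨k, x⟩, hi⟩ := Option.ne_none_iff_exists'.1 h1
    rw [hi]
    rw [uniqueMark_eq_some] at hi
    have hx := valMinAbs_mem_Icc L x
    have hinc : N k x.valMinAbs t - N k x.valMinAbs s = 1 := by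
      have := congrFun hi (k, x)
      simpa [increments] using this
    obtain ⟨u, hsu, hut, hvu, hlt⟩ := exists_jump (hN.mono k x.valMinAbs)
      (hN.rightCont k x.valMinAbs) (s := s) (t := t) (v := N k x.valMinAbs s + 1) (by omega)
      (by omega)
    set m₀ : Mark := ⟨u, k, x.valMinAbs⟩ with hm₀
    have hocc : m₀.Occurs N := ⟨zero_le.trans_lt hsu, fun r hr => (hlt r hr).trans_le hvu⟩
    have := hN.blockList_append (-L - 1) (L + 1) hst (r := [m₀]) (List.pairwise_singleton _ _)
      fun m => by
        rw [List.mem_singleton]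
        constructor
        · rintro rfl
          refine ⟨(mem_blockList hN.mono).2 ⟨hocc, hut, ?_, ?_⟩, hsu⟩
          · have := hx.1
            simp only [hm₀]
            omega
          · have := hx.2
            simp only [hm₀]
            omega
        · rintro ⟨hm, hs⟩
          obtain ⟨he, hpos⟩ := hmem m hm hs
          rw [hi] at hpos
          have heq : (m.kind, (m.edge : ZMod (2 * L + 1))) = (k, x) := by
            by_contra hne
            rw [Pi.single_eq_of_ne hne] at hpos
            exact lt_irrefl _ hpos
          obtain ⟨hk, hedge⟩ := Prod.mk.inj heq
          have hedge' : m.edge = x.valMinAbs := by rw [← hedge, valMinAbs_intCast L he]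
          obtain ⟨h1, h2, -⟩ := (mem_blockList hN.mono).1 hm
          have h3 := h1.2
          rw [hk, hedge'] at h3
          have h4 := hN.mono k x.valMinAbs h2
          refine hN.time_inj m m₀ h1 hocc ?_
          rcases lt_trichotomy m.time u with h | h | h
          · have := h3 s hs
            have := hlt _ h
            omega
          · exact h
          · have := h3 u h
            omega
    rw [this, runHeights_append]
    simp [runHeights, optStep, hm₀]

/-- If every interval of the subdivision `T` contains at most one mark, then the height is that of
the chain on the cycle. -/
lemma GoodEnv.height_eq_chainHeight (hN : GoodEnv N) (L : ℕ) {T : ℕ → ℝ≥0} (hT : Monotone T)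
    (hT0 : T 0 = 0) (m : ℕ) (h : ∀ j < m, AtMostOne (increments N L (T j) (T (j + 1)))) {a b : ℤ}
    (ha : a ∈ Set.Icc (-(L : ℤ)) (-1)) (hb : b ∈ Set.Icc 1 (L : ℤ)) (ha0 : ∀ k, N k a (T m) = 0)
    (hb0 : ∀ k, N k b (T m) = 0) :
    height N 0 (T m) =
      chainHeight (fun j : Fin m => uniqueMark (increments N L (T j) (T (j + 1)))) 0 := by
  have hua := unmarked_of_eq_zero hN.mono ha0
  have hub := unmarked_of_eq_zero hN.mono hb0
  obtain ⟨ha1, ha2⟩ := ha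
  obtain ⟨hb1, hb2⟩ := hb
  have hchain : ∀ m, (∀ j < m, AtMostOne (increments N L (T j) (T (j + 1)))) →
      runHeights (blockList N (-L - 1) (L + 1) (T m)) (0 : ZMod (2 * L + 1) → ℤ) =
        chainHeight fun j : Fin m => uniqueMark (increments N L (T j) (T (j + 1))) := by
    intro m hm
    induction m with
    | zero =>
      have : blockList N (-L - 1) (L + 1) (T 0) = [] := by
        refine List.eq_nil_iff_forall_not_mem.2 fun m hm => ?_
        obtain ⟨h1, h2, -⟩ := (mem_blockList hN.mono).1 hm
        rw [hT0] at h2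
        exact h1.1.not_ge h2
      rw [this]
      simp [runHeights, chainHeight]
    | succ m ih =>
      rw [hN.runHeights_step L (hT m.le_succ) (hm m m.lt_succ_self), chainHeight_succ,
        ih fun j hj => hm j (hj.trans m.lt_succ_self)]
      simp
  rw [← hchain m h, hN.height_eq (p := (a, b)) ⟨by simp only; omega, by simp only; omega, hua, hub⟩]
  -- The block of all edges `-L, …, L` is run on the cycle; the unmarked edges `a` and `b` shield
  -- the origin from the place where the cycle closes up.
  have := hN.runHeights_block (injOn_intCast_zmod L) (a := -L - 1) (b := L + 1) (a' := a) (b' := b)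
    (t := T m) (x := 0) (fun y hy => ⟨by have := hy.1; omega, by have := hy.2; omega⟩)
    (fun y hy => ⟨by have := hy.1; omega, by have := hy.2; omega⟩) (by omega) (by omega) hua hub
    ⟨by omega, by omega⟩
  rw [← this, Int.cast_zero]

end Mesh

/-! ### Independent steps and the law of the chain -/

section Independence

variable {Ω : Type*} [MeasurableSpace Ω] {P : Measure Ω}

/-- Grouping a doubly indexed independent family by its first index: the joint law is a product, and
currying a product measure gives a product of products. -/
lemma iIndepFun_curry {ι κ E : Type*} [MeasurableSpace E] {X : ι → κ → Ω → E}
    (mX : ∀ i j, Measurable (X i j)) (h : iIndepFun (fun (p : ι × κ) ω => X p.1 p.2 ω) P) :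
    iIndepFun (fun i ω j => X i j ω) P := by
  have := h.isProbabilityMeasure
  have : ∀ i j, IsProbabilityMeasure (P.map (X i j)) :=
    fun i j => Measure.isProbabilityMeasure_map (mX i j).aemeasurable
  have hi : ∀ i, iIndepFun (X i) P := fun i =>
    h.precomp (g := fun j => (i, j)) fun _ _ hj => (Prod.mk.inj hj).2
  rw [iIndepFun_iff_map_fun_eq_infinitePi_map (by fun_prop)] at h ⊢
  have e : (fun ω i j => X i j ω) =
      (MeasurableEquiv.curry ι κ E) ∘ fun ω (p : ι × κ) => X p.1 p.2 ω := rfl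
  rw [e, ← Measure.map_map (by fun_prop) (by fun_prop), h,
    Measure.infinitePi_map_curry fun i j => P.map (X i j)]
  congr 1
  ext1 i
  exact ((iIndepFun_iff_map_fun_eq_infinitePi_map (mX i)).1 (hi i)).symm

variable [IsProbabilityMeasure P]

/-- The law of the heights of the chain driven by independent steps. -/
lemma measureReal_chainHeight {V : Type*} [CommRing V] [DecidableEq V] [Fintype V] {m : ℕ}
    {ξ : Fin m → Ω → MarkKind × V → ℕ} (hm : ∀ j, Measurable (ξ j)) (hi : iIndepFun ξ P)
    {q : MarkKind → ℝ} (hq : ∀ j i, P.real {ω | ξ j ω = Pi.single i 1} = q i.1)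
    (B : Set (V → ℤ)) :
    P.real {ω | chainHeight (fun j => uniqueMark (ξ j ω)) ∈ B} =
      (transition q)^[m] (B.indicator 1) 0 := by
  classical
  have hmeas : ∀ j o, MeasurableSet ((fun ω => uniqueMark (ξ j ω)) ⁻¹' {o}) := fun j o =>
    hm j (MeasurableSet.of_discrete (s := {v | uniqueMark v = o}))
  have hsome : ∀ j i, P.real ((fun ω => uniqueMark (ξ j ω)) ⁻¹' {some i}) = q i.1 := by
    intro j i
    rw [← hq j i]
    congr 1
    ext ω
    exact uniqueMark_eq_some
  have hp : ∀ j o, P.real ((fun ω => uniqueMark (ξ j ω)) ⁻¹' {o}) = stepProb q o := by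
    rintro j (_ | i)
    -- The outcome `none` collects the remaining mass, whether no mark or several marks occurred.
    · have h1 := sum_measureReal_preimage_singleton (μ := P) Finset.univ
        (f := fun ω => uniqueMark (ξ j ω)) (fun o _ => hmeas j o)
      rw [Fintype.sum_option] at h1
      simp only [hsome, Finset.coe_univ, Set.preimage_univ, probReal_univ] at h1
      simp only [stepProb, Option.elim]
      linarith
    · exact hsome j i
  have hset : ∀ w : Fin m → Option (MarkKind × V),
      (fun ω j => uniqueMark (ξ j ω)) ⁻¹' {w} =
        ⋂ j, (fun ω => uniqueMark (ξ j ω)) ⁻¹' {w j} := by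
    intro w
    ext ω
    simp [funext_iff]
  have hw : ∀ w : Fin m → Option (MarkKind × V),
      P.real ((fun ω j => uniqueMark (ξ j ω)) ⁻¹' {w}) = ∏ j, stepProb q (w j) := by
    intro w
    rw [hset, measureReal_def, hi.meas_iInter (s := fun j => (fun ω => uniqueMark (ξ j ω)) ⁻¹' {w j})
      (fun j => ⟨{v | uniqueMark v = w j}, MeasurableSet.of_discrete, rfl⟩), ENNReal.toReal_prod]
    exact Finset.prod_congr rfl fun j _ => hp j (w j)
  have hB : {ω | chainHeight (fun j => uniqueMark (ξ j ω)) ∈ B} =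
      (fun ω j => uniqueMark (ξ j ω)) ⁻¹'
        ((Finset.univ.filter fun w : Fin m → Option (MarkKind × V) => chainHeight w ∈ B :
          Finset (Fin m → Option (MarkKind × V))) : Set (Fin m → Option (MarkKind × V))) := by
    ext ω
    simp
  rw [hB, ← sum_measureReal_preimage_singleton _ fun w _ => by
      rw [hset]
      exact MeasurableSet.iInter fun j => hmeas j _, ← sum_prod_stepProb_mul, Finset.sum_filter]
  refine Finset.sum_congr rfl fun w _ => ?_
  rw [hw, Set.indicator_apply]
  split_ifs <;> simp

end Independence

/-! ### Poisson increments -/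

section Poisson

variable {Ω : Type*} [MeasurableSpace Ω] {P : Measure Ω} {lam : ℝ≥0}
  {N : MarkKind → ℤ → ℝ≥0 → Ω → ℕ}

/-- The environment of the sample point `ω`. -/
def env (N : MarkKind → ℤ → ℝ≥0 → Ω → ℕ) (ω : Ω) : MarkKind → ℤ → ℝ≥0 → ℕ := fun k x s => N k x s ω

lemma IsPoissonProcess.measureReal_eq {N : ℝ≥0 → Ω → ℕ} {rate : ℝ≥0} (hN : IsPoissonProcess N rate P)
    {s t : ℝ≥0} (hst : s ≤ t) (n : ℕ) :
    P.real {ω | N t ω - N s ω = n} =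
      Real.exp (-(rate * (t - s) : ℝ≥0)) * (rate * (t - s) : ℝ≥0) ^ n / n.factorial := by
  have h := hN.law s t hst
  rw [← poissonMeasure_real_singleton, ← h.map_eq,
    measureReal_def, measureReal_def, Measure.map_apply_of_aemeasurable h.aemeasurable (by simp)]
  rfl

/-- The total intensity of the marks on an edge. -/
def edgeRate (lam : ℝ≥0) : ℝ := ∑ k : MarkKind, (k.rate lam : ℝ)

lemma edgeRate_eq (lam : ℝ≥0) : edgeRate lam = 2 + lam := by
  simp only [edgeRate, MarkKind.sum_univ, MarkKind.rate]
  push_cast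
  ring

namespace IsPoissonSystem

lemma measurable_increments (hN : IsPoissonSystem N lam P) (L : ℕ) (s t : ℝ≥0) :
    Measurable fun ω => increments (env N ω) L s t := by
  refine measurable_pi_lambda _ fun i => ?_
  have h1 := (hN.poisson i.1 i.2.valMinAbs).measurable t
  have h2 := (hN.poisson i.1 i.2.valMinAbs).measurable s
  exact h1.sub h2

/-- Independence between the processes and independence of increments within each one combine into
independence over all pairs of process and time interval, which are then regrouped by interval. -/
lemma iIndepFun_increments (hN : IsPoissonSystem N lam P) (L : ℕ) {T : ℕ → ℝ≥0}
    (hT : Monotone T) :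
    iIndepFun (fun (j : ℕ) ω => increments (env N ω) L (T j) (T (j + 1))) P := by
  set X : ℕ → MarkKind × ZMod (2 * L + 1) → Ω → ℕ := fun j i ω =>
    N i.1 i.2.valMinAbs (T (j + 1)) ω - N i.1 i.2.valMinAbs (T j) ω with hX
  have mX : ∀ j i, Measurable (X j i) := fun j i =>
    ((hN.poisson i.1 i.2.valMinAbs).measurable _).sub ((hN.poisson i.1 i.2.valMinAbs).measurable _)
  have h1 : iIndepFun (fun (i : MarkKind × ZMod (2 * L + 1)) ω (j : ℕ) => X j i ω) P :=
    (hN.indep.precomp (g := fun i : MarkKind × ZMod (2 * L + 1) => (i.1, i.2.valMinAbs))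
      (fun i i' h => by
        obtain ⟨h1, h2⟩ := Prod.mk.inj h
        exact Prod.ext h1 (ZMod.injective_valMinAbs h2))).comp
      (fun _ f j => f (T (j + 1)) - f (T j)) fun _ =>
        measurable_pi_lambda _ fun j => (measurable_pi_apply _).sub (measurable_pi_apply _)
  have h2 : ∀ i, iIndepFun (fun j => X j i) P := fun i =>
    (hN.poisson i.1 i.2.valMinAbs).indep.nat hT
  have h3 := iIndepFun_uncurry' (X := fun i j => X j i) (fun i j => mX j i) h1 h2
  have h4 : iIndepFun (fun (p : ℕ × (MarkKind × ZMod (2 * L + 1))) ω => X p.1 p.2 ω) P :=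
    h3.precomp (g := Prod.swap) Prod.swap_injective
  exact iIndepFun_curry mX h4

lemma measureReal_increments (hN : IsPoissonSystem N lam P) (L : ℕ) {s t : ℝ≥0} (hst : s ≤ t)
    (v : MarkKind × ZMod (2 * L + 1) → ℕ) :
    P.real {ω | increments (env N ω) L s t = v} =
      ∏ i : MarkKind × ZMod (2 * L + 1), (Real.exp (-(i.1.rate lam * (t - s) : ℝ≥0)) *
        (i.1.rate lam * (t - s) : ℝ≥0) ^ v i / (v i).factorial) := by
  have h1 : iIndepFun (fun (i : MarkKind × ZMod (2 * L + 1)) ω =>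
      N i.1 i.2.valMinAbs t ω - N i.1 i.2.valMinAbs s ω) P :=
    (hN.indep.precomp (g := fun i : MarkKind × ZMod (2 * L + 1) => (i.1, i.2.valMinAbs))
      (fun i i' h => by
        obtain ⟨h1, h2⟩ := Prod.mk.inj h
        exact Prod.ext h1 (ZMod.injective_valMinAbs h2))).comp
      (fun _ f => f t - f s) fun _ => (measurable_pi_apply _).sub (measurable_pi_apply _)
  have hset : {ω | increments (env N ω) L s t = v} =
      ⋂ i : MarkKind × ZMod (2 * L + 1),
        {ω | N i.1 i.2.valMinAbs t ω - N i.1 i.2.valMinAbs s ω = v i} := by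
    ext ω
    simp [funext_iff, increments, env]
  rw [hset, measureReal_def, h1.meas_iInter (s := fun i : MarkKind × ZMod (2 * L + 1) =>
      {ω | N i.1 i.2.valMinAbs t ω - N i.1 i.2.valMinAbs s ω = v i})
    (fun i => ⟨{v i}, MeasurableSet.of_discrete, rfl⟩), ENNReal.toReal_prod]
  exact Finset.prod_congr rfl fun i _ => (hN.poisson i.1 i.2.valMinAbs).measureReal_eq hst (v i)

lemma prod_exp_rate (L : ℕ) (τ : ℝ≥0) :
    ∏ i : MarkKind × ZMod (2 * L + 1), Real.exp (-(i.1.rate lam * τ : ℝ≥0)) =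
      Real.exp (-((2 * L + 1) * edgeRate lam * τ)) := by
  rw [← Real.exp_sum]
  congr 1
  rw [Fintype.sum_prod_type]
  simp only [NNReal.coe_mul, Finset.sum_neg_distrib, Finset.sum_const, Finset.card_univ, ZMod.card,
    nsmul_eq_mul, edgeRate, ← Finset.mul_sum, ← Finset.sum_mul]
  push_cast
  ring

lemma measureReal_increments_eq_zero (hN : IsPoissonSystem N lam P) (L : ℕ) {s t : ℝ≥0}
    (hst : s ≤ t) :
    P.real {ω | increments (env N ω) L s t = 0} =
      Real.exp (-((2 * L + 1) * edgeRate lam * (t - s : ℝ≥0))) := by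
  rw [hN.measureReal_increments L hst, ← prod_exp_rate]
  simp

/-- The probability that exactly one mark, of kind `k` and on a given edge, occurs among the edges
`-L, …, L` during a time `τ`. -/
def markProb (lam : ℝ≥0) (L : ℕ) (τ : ℝ≥0) (k : MarkKind) : ℝ :=
  k.rate lam * τ * Real.exp (-((2 * L + 1) * edgeRate lam * τ))

lemma measureReal_increments_eq_single (hN : IsPoissonSystem N lam P) (L : ℕ) {s t : ℝ≥0}
    (hst : s ≤ t) (i : MarkKind × ZMod (2 * L + 1)) :
    P.real {ω | increments (env N ω) L s t = Pi.single i 1} = markProb lam L (t - s) i.1 := by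
  rw [hN.measureReal_increments L hst, markProb, ← prod_exp_rate]
  have : ∀ i' : MarkKind × ZMod (2 * L + 1), Real.exp (-(i'.1.rate lam * (t - s) : ℝ≥0)) *
        (i'.1.rate lam * (t - s) : ℝ≥0) ^ ((Pi.single i 1 : _ → ℕ) i') /
          ((Pi.single i 1 : _ → ℕ) i').factorial =
      Real.exp (-(i'.1.rate lam * (t - s) : ℝ≥0)) *
        if i' = i then ((i.1.rate lam * (t - s) : ℝ≥0) : ℝ) else 1 := by
    intro i'
    by_cases h : i' = i
    · subst h
      simp
    · simp [h]
  rw [Finset.prod_congr rfl fun i' _ => this i', Finset.prod_mul_distrib, Finset.prod_ite_eq']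
  simp
  ring

lemma sum_markProb (lam : ℝ≥0) (L : ℕ) (τ : ℝ≥0) :
    ∑ i : MarkKind × ZMod (2 * L + 1), markProb lam L τ i.1 =
      (2 * L + 1) * edgeRate lam * τ * Real.exp (-((2 * L + 1) * edgeRate lam * τ)) := by
  rw [Fintype.sum_prod_type]
  simp only [markProb, Finset.sum_const, Finset.card_univ, ZMod.card, nsmul_eq_mul, edgeRate,
    ← Finset.mul_sum, ← Finset.sum_mul]
  push_cast
  ring

lemma isStepWeight_markProb (lam : ℝ≥0) (L : ℕ) (τ : ℝ≥0) :
    IsStepWeight (ZMod (2 * L + 1)) (markProb lam L τ) where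
  nonneg k := by unfold markProb; positivity
  arrow k hk := by cases k <;> simp_all [markProb, MarkKind.rate]
  sum_le := by
    rw [sum_markProb, Real.exp_neg, ← div_eq_mul_inv, div_le_one (Real.exp_pos _)]
    have := Real.add_one_le_exp ((2 * L + 1) * edgeRate lam * τ)
    linarith

lemma edgeRate_nonneg (lam : ℝ≥0) : 0 ≤ edgeRate lam := by rw [edgeRate_eq]; positivity

lemma measurableSet_atMostOne (hN : IsPoissonSystem N lam P) (L : ℕ) (s t : ℝ≥0) :
    MeasurableSet {ω | AtMostOne (increments (env N ω) L s t)} :=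
  hN.measurable_increments L s t (MeasurableSet.of_discrete (s := {v | AtMostOne v}))

variable [IsProbabilityMeasure P]

/-- With `x` the mean number of marks, zero or one mark has probability `(1 + x) * exp (-x)`, which
is at least `(1 + x) * (1 - x) = 1 - x ^ 2`. -/
lemma measureReal_not_atMostOne_le (hN : IsPoissonSystem N lam P) (L : ℕ) {s t : ℝ≥0}
    (hst : s ≤ t) :
    P.real {ω | ¬ AtMostOne (increments (env N ω) L s t)} ≤
      ((2 * L + 1) * edgeRate lam * (t - s : ℝ≥0)) ^ 2 := by
  classical
  set x : ℝ := (2 * L + 1) * edgeRate lam * (t - s : ℝ≥0) with hx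
  have hx0 : 0 ≤ x := by have := edgeRate_nonneg lam; positivity
  have hone : P.real {ω | AtMostOne (increments (env N ω) L s t)} =
      Real.exp (-x) + x * Real.exp (-x) := by
    set f : Ω → (MarkKind × ZMod (2 * L + 1) → ℕ) := fun ω => increments (env N ω) L s t with hf
    set A : Finset (MarkKind × ZMod (2 * L + 1) → ℕ) :=
      insert 0 (Finset.univ.image fun i => Pi.single i 1) with hA
    have hset : {ω | AtMostOne (increments (env N ω) L s t)} = f ⁻¹' A := by
      ext ω
      simp only [hA, hf, AtMostOne, Set.mem_ofPred_eq, Set.mem_preimage, Finset.mem_coe,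
        Finset.mem_insert, Finset.mem_image, Finset.mem_univ, true_and, Option.ne_none_iff_exists',
        uniqueMark_eq_some, eq_comm (b := increments (env N ω) L s t)]
    rw [hset, ← sum_measureReal_preimage_singleton _ fun v _ =>
      hN.measurable_increments L s t (MeasurableSet.of_discrete (s := {v})), hA,
      Finset.sum_insert (by simp [Finset.mem_image]), Finset.sum_image fun i _ i' _ h => by
        have h1 := congrFun h i
        by_contra hne
        simp only [Pi.single_eq_same, Pi.single_eq_of_ne hne] at h1
        exact one_ne_zero h1]
    have e0 : P.real (f ⁻¹' {0}) = Real.exp (-x) := hN.measureReal_increments_eq_zero L hst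
    have e1 : ∀ i, P.real (f ⁻¹' {Pi.single i 1}) = markProb lam L (t - s) i.1 :=
      hN.measureReal_increments_eq_single L hst
    rw [e0, Finset.sum_congr rfl fun i _ => e1 i, sum_markProb]
  have hcompl := probReal_compl_eq_one_sub (μ := P) (hN.measurableSet_atMostOne L s t)
  have : {ω | ¬ AtMostOne (increments (env N ω) L s t)} =
    {ω | AtMostOne (increments (env N ω) L s t)}ᶜ := rfl
  rw [this, hcompl, hone]
  have := Real.add_one_le_exp (-x)
  nlinarith

/-- The number `m` of equal subintervals of `[0, t]` is large enough to separate the marks on the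
edges `-L, …, L`. -/
def Separates (N : MarkKind → ℤ → ℝ≥0 → ℕ) (L : ℕ) (t : ℝ≥0) (m : ℕ) : Prop :=
  ∀ j < m, AtMostOne (increments N L (j * (t / m)) ((j + 1 : ℕ) * (t / m)))

/-- Union bound: each of the `m` intervals fails with probability of order `1 / m ^ 2`. -/
lemma measureReal_not_separates_le (hN : IsPoissonSystem N lam P) (L : ℕ) (t : ℝ≥0) (m : ℕ) :
    P.real {ω | ¬ Separates (env N ω) L t m} ≤ ((2 * L + 1) * edgeRate lam * t) ^ 2 / m := by
  rcases m.eq_zero_or_pos with rfl | hm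
  · simp [Separates]
  have hset : {ω | ¬ Separates (env N ω) L t m} = ⋃ j ∈ Finset.range m,
      {ω | ¬ AtMostOne (increments (env N ω) L (j * (t / m)) ((j + 1 : ℕ) * (t / m)))} := by
    ext ω
    simp [Separates]
  rw [hset]
  refine (measureReal_biUnion_finset_le _ _).trans ?_
  have hb : ∀ j ∈ Finset.range m,
      P.real {ω | ¬ AtMostOne (increments (env N ω) L (j * (t / m)) ((j + 1 : ℕ) * (t / m)))} ≤
        ((2 * L + 1) * edgeRate lam * (t / m)) ^ 2 := by
    intro j _
    have h1 : (j : ℝ≥0) * (t / m) ≤ (j + 1 : ℕ) * (t / m) := by gcongr; simp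
    refine (hN.measureReal_not_atMostOne_le L h1).trans_eq ?_
    congr 2
    rw [NNReal.coe_sub h1]
    push_cast
    ring
  refine (Finset.sum_le_sum hb).trans_eq ?_
  simp only [Finset.sum_const, Finset.card_range, nsmul_eq_mul]
  have : (m : ℝ) ≠ 0 := by positivity
  field_simp

end IsPoissonSystem

end Poisson

/-! ### Almost sure regularity of the environment -/

section Poisson

variable {Ω : Type*} [MeasurableSpace Ω] {P : Measure Ω} {lam : ℝ≥0}
  {N : MarkKind → ℤ → ℝ≥0 → Ω → ℕ}

namespace IsPoissonSystem

variable [IsProbabilityMeasure P]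

/-- Distinct edges are independent, and each is free of marks with probability `exp (-(edgeRate lam
* t))`. Increments from time `0` are used because the processes vanish there only almost surely. -/
lemma measureReal_marked_le (hN : IsPoissonSystem N lam P) (t : ℝ≥0) {e : ℕ → ℤ}
    (he : Function.Injective e) (L : ℕ) :
    P.real {ω | ∀ j < L, ∃ k, N k (e j) t ω - N k (e j) 0 ω ≠ 0} ≤
      (1 - Real.exp (-(edgeRate lam * t))) ^ L := by
  set X : ℕ → MarkKind → Ω → ℕ := fun j k ω => N k (e j) t ω - N k (e j) 0 ω with hX
  have mX : ∀ j k, Measurable (X j k) := fun j k =>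
    ((hN.poisson k (e j)).measurable _).sub ((hN.poisson k (e j)).measurable _)
  have h1 : iIndepFun (fun (p : ℕ × MarkKind) ω => X p.1 p.2 ω) P :=
    (hN.indep.precomp (g := fun p : ℕ × MarkKind => (p.2, e p.1))
      (fun p p' h => by
        obtain ⟨h1, h2⟩ := Prod.mk.inj h
        exact Prod.ext (he h2) h1)).comp
      (fun _ f => f t - f 0) fun _ => (measurable_pi_apply _).sub (measurable_pi_apply _)
  have h2 := iIndepFun_curry mX h1
  have h3 : ∀ j, P.real {ω | ∀ k, X j k ω = 0} = Real.exp (-(edgeRate lam * t)) := by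
    intro j
    have h4 : iIndepFun (X j) P :=
      h1.precomp (g := fun k => (j, k)) fun _ _ hj => (Prod.mk.inj hj).2
    have hset : {ω | ∀ k, X j k ω = 0} = ⋂ k, {ω | X j k ω = 0} := by ext; simp
    rw [hset, measureReal_def, h4.meas_iInter (s := fun k => {ω | X j k ω = 0})
      (fun k => ⟨{0}, MeasurableSet.of_discrete, rfl⟩), ENNReal.toReal_prod, edgeRate,
      Finset.sum_mul, ← Finset.sum_neg_distrib, Real.exp_sum]
    refine Finset.prod_congr rfl fun k _ => ?_
    have := (hN.poisson k (e j)).measureReal_eq (zero_le (a := t)) 0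
    simpa [measureReal_def, hX] using this
  have h5 : ∀ j, P.real {ω | ∃ k, X j k ω ≠ 0} = 1 - Real.exp (-(edgeRate lam * t)) := by
    intro j
    rw [← h3 j, ← probReal_compl_eq_one_sub]
    · congr 1
      ext ω
      simp
    · exact (measurable_pi_lambda _ (mX j) : Measurable fun ω k => X j k ω)
        (MeasurableSet.of_discrete (s := {v | ∀ k, v k = 0}))
  have hset : {ω | ∀ j < L, ∃ k, N k (e j) t ω - N k (e j) 0 ω ≠ 0} =
      ⋂ j ∈ Finset.range L, {ω | ∃ k, X j k ω ≠ 0} := by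
    ext ω
    simp [hX]
  rw [hset, measureReal_def, h2.meas_biInter (s := fun j => {ω | ∃ k, X j k ω ≠ 0})
    fun j _ => ⟨{v | ∃ k, v k ≠ 0}, MeasurableSet.of_discrete, rfl⟩, ENNReal.toReal_prod]
  refine (Finset.prod_congr rfl fun j _ => h5 j).trans_le ?_
  simp

lemma tendsto_marked_bound (lam t : ℝ≥0) :
    Tendsto (fun L : ℕ => (1 - Real.exp (-(edgeRate lam * t))) ^ L) atTop (𝓝 0) := by
  have h0 := edgeRate_nonneg lam
  refine tendsto_pow_atTop_nhds_zero_of_lt_one ?_ ?_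
  · rw [sub_nonneg, Real.exp_le_one_iff, neg_nonpos]
    positivity
  · have := Real.exp_pos (-(edgeRate lam * t))
    linarith

lemma ae_exists_unmarked (hN : IsPoissonSystem N lam P) (t : ℝ≥0) {e : ℕ → ℤ}
    (he : Function.Injective e) :
    ∀ᵐ ω ∂P, ∃ j, ∀ k, N k (e j) t ω - N k (e j) 0 ω = 0 := by
  rw [ae_iff, ← measureReal_eq_zero_iff]
  refine le_antisymm (ge_of_tendsto' (tendsto_marked_bound lam t) fun L => ?_) measureReal_nonneg
  refine le_trans (measureReal_mono fun ω hω => ?_) (hN.measureReal_marked_le t he L)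
  intro j _
  by_contra! h
  exact hω ⟨j, h⟩

lemma ae_exists_separates (hN : IsPoissonSystem N lam P) (L : ℕ) (t : ℝ≥0) :
    ∀ᵐ ω ∂P, ∃ m, 0 < m ∧ Separates (env N ω) L t m := by
  rw [ae_iff, ← measureReal_eq_zero_iff]
  have hlim : Tendsto (fun m : ℕ => ((2 * L + 1) * edgeRate lam * t) ^ 2 / ((m + 1 : ℕ) : ℝ)) atTop
      (𝓝 0) :=
    (tendsto_const_div_atTop_nhds_zero_nat _).comp (tendsto_add_atTop_nat 1)
  refine le_antisymm (ge_of_tendsto' hlim fun m => ?_) measureReal_nonneg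
  refine le_trans (measureReal_mono fun ω hω => ?_) (hN.measureReal_not_separates_le L t (m + 1))
  exact fun h => hω ⟨m + 1, m.succ_pos, h⟩

end IsPoissonSystem

open IsPoissonSystem

lemma AtMostOne.le_one {ι : Type*} [DecidableEq ι] {ξ : ι → ℕ} (h : AtMostOne ξ) (i : ι) :
    ξ i ≤ 1 := by
  rcases h with rfl | h
  · simp
  · obtain ⟨j, hj⟩ := Option.ne_none_iff_exists'.1 h
    rw [uniqueMark_eq_some] at hj
    rw [hj, Pi.single_apply]
    split_ifs <;> simp

lemma AtMostOne.eq_of_pos {ι : Type*} [DecidableEq ι] {ξ : ι → ℕ} (h : AtMostOne ξ) {i i' : ι}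
    (hi : 0 < ξ i) (hi' : 0 < ξ i') : i = i' := by
  rcases h with rfl | h
  · simp at hi
  · obtain ⟨j, hj⟩ := Option.ne_none_iff_exists'.1 h
    rw [uniqueMark_eq_some] at hj
    rw [hj, Pi.single_apply] at hi hi'
    split_ifs at hi hi' with h1 h2
    · rw [h1, h2]
    all_goals simp_all

lemma exists_mesh_interval {t u : ℝ≥0} {m : ℕ} (hm : 0 < m) (hu : 0 < u) (hut : u ≤ t) :
    ∃ j < m, (j : ℝ≥0) * (t / m) < u ∧ u ≤ (j + 1 : ℕ) * (t / m) := by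
  have hm' : (m : ℝ≥0) ≠ 0 := by positivity
  have hex : ∃ j : ℕ, u ≤ (j + 1 : ℕ) * (t / m) := by
    refine ⟨m - 1, ?_⟩
    rw [Nat.sub_add_cancel hm, mul_div_cancel₀ _ hm']
    exact hut
  classical
  refine ⟨Nat.find hex, ?_, ?_, Nat.find_spec hex⟩
  · have : Nat.find hex ≤ m - 1 := Nat.find_min' hex (by
      rw [Nat.sub_add_cancel hm, mul_div_cancel₀ _ hm']
      exact hut)
    omega
  · rcases hf : Nat.find hex with _ | j
    · simpa using hu
    · exact not_le.1 (Nat.find_min hex (m := j) (by omega))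

/-- Almost every environment is good. -/
lemma IsPoissonSystem.ae_goodEnv [IsProbabilityMeasure P] (hN : IsPoissonSystem N lam P) :
    ∀ᵐ ω ∂P, GoodEnv (env N ω) := by
  have h1 : ∀ᵐ ω ∂P, ∀ k x, N k x 0 ω = 0 :=
    ae_all_iff.2 fun k => ae_all_iff.2 fun x => (hN.poisson k x).zero
  have h2 : ∀ᵐ ω ∂P, ∀ k x, Monotone fun t => N k x t ω :=
    ae_all_iff.2 fun k => ae_all_iff.2 fun x => (hN.poisson k x).mono
  have h3 : ∀ᵐ ω ∂P, ∀ k x, ∀ t, ContinuousWithinAt (fun s => N k x s ω) (Set.Ici t) t :=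
    ae_all_iff.2 fun k => ae_all_iff.2 fun x => (hN.poisson k x).rightCont
  -- Integer times suffice by monotonicity, which keeps the exceptional events countable. A
  -- separating mesh yields both unit jumps and distinct mark times.
  have h4 : ∀ᵐ ω ∂P, ∀ L t : ℕ, ∃ m, 0 < m ∧ Separates (env N ω) L t m :=
    ae_all_iff.2 fun L => ae_all_iff.2 fun t => hN.ae_exists_separates L t
  have h5 : ∀ᵐ ω ∂P, ∀ t : ℕ, ∃ j : ℕ, ∀ k, N k (j + 1) t ω - N k (j + 1) 0 ω = 0 :=
    ae_all_iff.2 fun t => hN.ae_exists_unmarked t (e := fun j => (j : ℤ) + 1)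
      fun i j h => by simpa using h
  have h6 : ∀ᵐ ω ∂P, ∀ t : ℕ, ∃ j : ℕ, ∀ k, N k (-(j + 1)) t ω - N k (-(j + 1)) 0 ω = 0 :=
    ae_all_iff.2 fun t => hN.ae_exists_unmarked t (e := fun j => -((j : ℤ) + 1))
      fun i j h => by simpa using h
  filter_upwards [h1, h2, h3, h4, h5, h6] with ω h1 h2 h3 h4 h5 h6
  have hmono : ∀ k x, Monotone (env N ω k x) := h2
  refine ⟨h1, h2, h3, ?_, ?_, ?_⟩
  · intro k x u hu
    obtain ⟨t, ht⟩ := exists_nat_ge u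
    obtain ⟨m, hm, hs⟩ := h4 x.natAbs t
    obtain ⟨j, hj, hju, huj⟩ := exists_mesh_interval hm hu ht
    refine ⟨_, hju, (hmono k x huj).trans ?_⟩
    have := (hs j hj).le_one (k, (x : ZMod (2 * x.natAbs + 1)))
    rw [increments, valMinAbs_intCast _ ⟨by omega, by omega⟩] at this
    simp only at this
    omega
  · intro m m' hm hm' he
    obtain ⟨t, ht⟩ := exists_nat_ge m.time
    set L := max m.edge.natAbs m'.edge.natAbs with hL
    have hL1 : m.edge.natAbs ≤ L := le_max_left _ _
    have hL2 : m'.edge.natAbs ≤ L := le_max_right _ _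
    have hmL : m.edge ∈ Set.Icc (-(L : ℤ)) L := ⟨by omega, by omega⟩
    have hmL' : m'.edge ∈ Set.Icc (-(L : ℤ)) L := ⟨by omega, by omega⟩
    obtain ⟨n, hn, hs⟩ := h4 L t
    obtain ⟨j, hj, hju, huj⟩ := exists_mesh_interval hn hm.1 ht
    have heq := (hs j hj).eq_of_pos (hm.increments_pos hmono hmL hju huj)
      (hm'.increments_pos hmono hmL' (he ▸ hju) (he ▸ huj))
    obtain ⟨hk, hx⟩ := Prod.mk.inj heq
    have hx' := injOn_intCast_zmod L hmL hmL' hx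
    cases m
    cases m'
    simp_all
  · intro t
    obtain ⟨n, hn⟩ := exists_nat_ge t
    obtain ⟨b, hb⟩ := h5 n
    obtain ⟨a, ha⟩ := h6 n
    refine ⟨(-((a : ℤ) + 1), (b : ℤ) + 1), Isolates.anti hn ?_⟩
    refine ⟨by simp only; omega, by simp only; omega, unmarked_of_eq_zero hmono fun k => ?_,
      unmarked_of_eq_zero hmono fun k => ?_⟩
    · have := ha k
      rw [h1] at this
      exact this
    · have := hb k
      rw [h1] at this
      exact this

end Poisson

/-! ### Fluctuation bound and passage to the limit -/

section Limit

variable {Ω : Type*} [MeasurableSpace Ω] {P : Measure Ω} {lam : ℝ≥0}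
  {N : MarkKind → ℤ → ℝ≥0 → Ω → ℕ}

namespace IsPoissonSystem

lemma mul_markProb_nucleation (lam : ℝ≥0) (L : ℕ) (t : ℝ≥0) {m : ℕ} (hm : 0 < m) :
    m * markProb lam L (t / m) .nucleation =
      lam * t * Real.exp (-((2 * L + 1) * edgeRate lam * t / m)) := by
  have hm' : (m : ℝ) ≠ 0 := by positivity
  simp only [markProb, MarkKind.rate, NNReal.coe_div, NNReal.coe_natCast, mul_div_assoc]
  field_simp

lemma mul_markProb_le (lam : ℝ≥0) (L : ℕ) (t : ℝ≥0) {m : ℕ} (hm : 0 < m) :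
    m * (4 * markProb lam L (t / m) .leftArrowR + markProb lam L (t / m) .nucleation) ≤
      (2 + lam) * t := by
  have hm' : (m : ℝ) ≠ 0 := by positivity
  have h0 := edgeRate_nonneg lam
  have e : m * (4 * markProb lam L (t / m) .leftArrowR + markProb lam L (t / m) .nucleation) =
      (2 + lam) * t * Real.exp (-((2 * L + 1) * edgeRate lam * (t / m : ℝ≥0))) := by
    simp only [markProb, MarkKind.rate]
    push_cast
    field_simp
    ring
  rw [e]
  refine mul_le_of_le_one_right (by positivity) ?_
  rw [Real.exp_le_one_iff, neg_nonpos]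
  positivity

variable [IsProbabilityMeasure P]

/-- The bound on the fluctuations of the height that results from a discretization into `m` time
intervals and a restriction to the edges `-L, …, L`. -/
lemma measureReal_height_le_mesh (hN : IsPoissonSystem N lam P) (t : ℝ≥0) {a : ℝ} (ha : 0 < a)
    (L : ℕ) {m : ℕ} (hm : 0 < m) :
    P.real {ω | a ≤ |(height (env N ω) 0 t : ℝ) - lam * t|} ≤
      ((2 * L + 1) * edgeRate lam * t) ^ 2 / m
        + 2 * (1 - Real.exp (-(edgeRate lam * t))) ^ L
        + ((2 + lam) * t + (lam * t * Real.exp (-((2 * L + 1) * edgeRate lam * t / m))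
          - lam * t) ^ 2) / a ^ 2 := by
  set T : ℕ → ℝ≥0 := fun j => j * (t / m) with hT
  have hm' : (m : ℝ≥0) ≠ 0 := by positivity
  have hTmono : Monotone T := fun i j hij => by simp only [hT]; gcongr
  have hT0 : T 0 = 0 := by simp [hT]
  have hTm : T m = t := by simp only [hT]; exact mul_div_cancel₀ _ hm'
  have hTd : ∀ j, T (j + 1) - T j = t / m := fun j => by
    simp only [hT]
    push_cast
    rw [add_mul, one_mul, add_tsub_cancel_left]
  set q := markProb lam L (t / m) with hq
  have hqw : IsStepWeight (ZMod (2 * L + 1)) q := isStepWeight_markProb lam L (t / m)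
  set ξ : Fin m → Ω → MarkKind × ZMod (2 * L + 1) → ℕ := fun j ω =>
    increments (env N ω) L (T j) (T (j + 1)) with hξ
  have hchain := measureReal_chainHeight (P := P) (ξ := ξ)
    (fun j => hN.measurable_increments L _ _)
    ((hN.iIndepFun_increments L hTmono).precomp Fin.val_injective) (q := q)
    (fun j i => by
      rw [hq, ← hTd j]
      exact hN.measureReal_increments_eq_single L (hTmono (Nat.le_succ _)) i)
    {h | a ≤ |(h 0 : ℝ) - lam * t|}
  have hcheb := transition_iterate_indicator_le hqw m (lam * t) ha
  rw [← hchain] at hcheb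
  -- Outside the first four events, which are a bad environment, an insufficient mesh, and no
  -- unmarked edge to the right or to the left within distance `L`, the height is that of the chain.
  have hsub : {ω | a ≤ |(height (env N ω) 0 t : ℝ) - lam * t|} ⊆
      {ω | ¬ GoodEnv (env N ω)} ∪ ({ω | ¬ Separates (env N ω) L t m} ∪
      ({ω | ∀ j < L, ∃ k, N k ((j : ℤ) + 1) t ω - N k ((j : ℤ) + 1) 0 ω ≠ 0} ∪
      ({ω | ∀ j < L, ∃ k, N k (-((j : ℤ) + 1)) t ω - N k (-((j : ℤ) + 1)) 0 ω ≠ 0} ∪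
      {ω | chainHeight (fun j => uniqueMark (ξ j ω)) ∈
        {h : ZMod (2 * L + 1) → ℤ | a ≤ |(h 0 : ℝ) - lam * t|}}))) := by
    intro ω hω
    by_contra hcon
    simp only [Set.mem_union, Set.mem_ofPred_eq, not_or, not_not] at hcon
    obtain ⟨hg, hs, hb, ha', hc⟩ := hcon
    push Not at hb ha'
    obtain ⟨b, hbL, hb⟩ := hb
    obtain ⟨c, hcL, hc'⟩ := ha'
    have := hg.height_eq_chainHeight L hTmono hT0 m hs (a := -((c : ℤ) + 1)) (b := (b : ℤ) + 1)
      ⟨by omega, by omega⟩ ⟨by omega, by omega⟩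
      (fun k => by
        rw [hTm]
        have h1 := hc' k
        have h0 : N k (-((c : ℤ) + 1)) 0 ω = 0 := hg.zero k _
        rw [h0] at h1
        exact h1)
      (fun k => by
        rw [hTm]
        have h1 := hb k
        have h0 : N k ((b : ℤ) + 1) 0 ω = 0 := hg.zero k _
        rw [h0] at h1
        exact h1)
    rw [hTm] at this
    rw [Set.mem_ofPred_eq, this] at hω
    exact hc hω
  have hg0 : P.real {ω | ¬ GoodEnv (env N ω)} = 0 := by
    rw [measureReal_eq_zero_iff]
    exact ae_iff.1 hN.ae_goodEnv
  have hb := hN.measureReal_marked_le t (e := fun j => (j : ℤ) + 1) (fun i j h => by simpa using h) L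
  have hc := hN.measureReal_marked_le t (e := fun j => -((j : ℤ) + 1))
    (fun i j h => by simpa using h) L
  have hs := hN.measureReal_not_separates_le L t m
  rw [hq, mul_markProb_nucleation lam L t hm] at hcheb
  have hcheb' := hcheb.trans (div_le_div_of_nonneg_right
    (add_le_add_left (mul_markProb_le lam L t hm) _) (by positivity))
  have hu : ∀ A₁ A₂ A₃ A₄ A₅ : Set Ω, P.real (A₁ ∪ (A₂ ∪ (A₃ ∪ (A₄ ∪ A₅)))) ≤
      P.real A₁ + (P.real A₂ + (P.real A₃ + (P.real A₄ + P.real A₅))) := fun A₁ A₂ A₃ A₄ A₅ =>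
    (measureReal_union_le _ _).trans <| add_le_add_right ((measureReal_union_le _ _).trans <|
      add_le_add_right ((measureReal_union_le _ _).trans <|
        add_le_add_right (measureReal_union_le _ _) _) _) _
  refine (measureReal_mono hsub).trans ((hu _ _ _ _ _).trans ?_)
  linarith

/-- The fluctuations of the height at time `t` are at most of order `√t`. -/
lemma measureReal_height_le (hN : IsPoissonSystem N lam P) (t : ℝ≥0) {a : ℝ} (ha : 0 < a) :
    P.real {ω | a ≤ |(height (env N ω) 0 t : ℝ) - lam * t|} ≤ (2 + lam) * t / a ^ 2 := by
  have hL : ∀ L : ℕ, P.real {ω | a ≤ |(height (env N ω) 0 t : ℝ) - lam * t|} ≤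
      2 * (1 - Real.exp (-(edgeRate lam * t))) ^ L + (2 + lam) * t / a ^ 2 := by
    intro L
    set K : ℝ := (2 * L + 1) * edgeRate lam * t with hK
    have h1 : Tendsto (fun m : ℕ => K ^ 2 / (m : ℝ)) atTop (𝓝 0) :=
      tendsto_const_div_atTop_nhds_zero_nat _
    have h2 : Tendsto (fun m : ℕ => Real.exp (-(K / m))) atTop (𝓝 1) := by
      have := (tendsto_const_div_atTop_nhds_zero_nat K).neg
      rw [neg_zero] at this
      simpa [Function.comp_def] using (Real.continuous_exp.tendsto 0).comp this
    have h3 : Tendsto (fun m : ℕ => K ^ 2 / m + 2 * (1 - Real.exp (-(edgeRate lam * t))) ^ L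
        + ((2 + lam) * t + (lam * t * Real.exp (-(K / m)) - lam * t) ^ 2) / a ^ 2) atTop
        (𝓝 (0 + 2 * (1 - Real.exp (-(edgeRate lam * t))) ^ L
          + ((2 + lam) * t + (lam * t * 1 - lam * t) ^ 2) / a ^ 2)) :=
      (h1.add_const _).add
        (((((h2.const_mul _).sub_const _).pow 2).const_add _).div_const _)
    -- The order of limits matters: the mesh error grows with `L`, so `m → ∞` is taken first with
    -- `L` fixed.
    have h4 := ge_of_tendsto h3 ((eventually_gt_atTop 0).mono fun m hm =>
      hN.measureReal_height_le_mesh t ha L hm)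
    simpa using h4
  have hlim : Tendsto (fun L : ℕ => 2 * (1 - Real.exp (-(edgeRate lam * t))) ^ L
      + (2 + lam) * t / a ^ 2) atTop (𝓝 (2 * 0 + (2 + lam) * t / a ^ 2)) :=
    ((tendsto_marked_bound lam t).const_mul 2).add_const _
  simpa using ge_of_tendsto' hlim hL

/-- The law of large numbers along the squares. -/
lemma ae_tendsto_height_sq (hN : IsPoissonSystem N lam P) :
    ∀ᵐ ω ∂P, Tendsto (fun n : ℕ => (height (env N ω) 0 ((n ^ 2 : ℕ) : ℝ≥0) : ℝ) / (n : ℝ) ^ 2) atTop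
      (𝓝 (lam : ℝ)) := by
  have hev : ∀ i : ℕ, ∀ᵐ ω ∂P, ∀ᶠ n : ℕ in atTop,
      -- The clause `0 < n` makes the event at `n = 0` empty; without it the threshold there would
      -- be zero.
      ω ∉ {ω | (1 / (i + 1 : ℝ)) * (n : ℝ) ^ 2 ≤
        |(height (env N ω) 0 ((n ^ 2 : ℕ) : ℝ≥0) : ℝ) - lam * ((n ^ 2 : ℕ) : ℝ≥0)| ∧ 0 < n} := by
    intro i
    refine ae_eventually_notMem ?_
    -- The fluctuation bound with time `n ^ 2` and threshold `n ^ 2 / (i + 1)` gives this summable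
    -- sequence for Borel–Cantelli.
    have hsum : Summable fun n : ℕ => (2 + lam) * (i + 1 : ℝ) ^ 2 * (1 / (n : ℝ) ^ 2) :=
      (Real.summable_one_div_nat_pow.2 one_lt_two).mul_left _
    refine ne_top_of_le_ne_top hsum.tsum_ofReal_ne_top (ENNReal.tsum_le_tsum fun n => ?_)
    rcases n.eq_zero_or_pos with rfl | hn
    · simp
    · rw [← ofReal_measureReal]
      refine ENNReal.ofReal_le_ofReal ?_
      have hn' : (0 : ℝ) < n := by positivity
      have hpos : (0 : ℝ) < (1 / (i + 1 : ℝ)) * (n : ℝ) ^ 2 := by positivity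
      refine (measureReal_mono fun ω hω => hω.1).trans
        ((hN.measureReal_height_le ((n ^ 2 : ℕ) : ℝ≥0) hpos).trans_eq ?_)
      push_cast
      field_simp
  filter_upwards [ae_all_iff.2 hev] with ω hω
  rw [Metric.tendsto_atTop']
  intro ε hε
  obtain ⟨i, hi⟩ := exists_nat_one_div_lt hε
  obtain ⟨n₀, hn₀⟩ := eventually_atTop.1 (hω i)
  refine ⟨n₀, fun n hn => ?_⟩
  have h1 := hn₀ n hn.le
  have hn0 : 0 < n := by omega
  have hn' : (0 : ℝ) < (n : ℝ) ^ 2 := by positivity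
  simp only [hn0, and_true, not_le] at h1
  rw [Real.dist_eq]
  refine lt_trans ?_ hi
  push_cast at h1
  rw [show (height (env N ω) 0 ((n ^ 2 : ℕ) : ℝ≥0) : ℝ) / (n : ℝ) ^ 2 - lam =
    ((height (env N ω) 0 ((n ^ 2 : ℕ) : ℝ≥0) : ℝ) - lam * (n : ℝ) ^ 2) / (n : ℝ) ^ 2 by field_simp,
    abs_div, abs_of_pos hn', div_lt_iff₀ hn']
  push_cast
  exact h1

end IsPoissonSystem

lemma integrable_natCast_poissonMeasure (r : ℝ≥0) :
    Integrable (fun n : ℕ => (n : ℝ)) (poissonMeasure r) := by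
  rw [integrable_poissonMeasure_iff, ← summable_nat_add_iff 1]
  have h := (Real.summable_pow_div_factorial (r : ℝ)).mul_left (Real.exp (-r) * r)
  refine h.congr fun n => ?_
  rw [Nat.factorial_succ, Real.norm_of_nonneg (by positivity)]
  push_cast
  field_simp
  ring

/-- The law of large numbers for a Poisson process. -/
lemma IsPoissonProcess.ae_tendsto [IsProbabilityMeasure P] {N : ℝ≥0 → Ω → ℕ} {rate : ℝ≥0}
    (hN : IsPoissonProcess N rate P) :
    ∃ c : ℝ, ∀ᵐ ω ∂P, Tendsto (fun n : ℕ => (N n ω : ℝ) / n) atTop (𝓝 c) := by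
  set Y : ℕ → Ω → ℕ := fun j ω => N ((j + 1 : ℕ) : ℝ≥0) ω - N (j : ℝ≥0) ω with hY
  have hlaw : ∀ j, HasLaw (Y j) (poissonMeasure rate) P := fun j => by
    have := hN.law (j : ℝ≥0) ((j + 1 : ℕ) : ℝ≥0) (by simp)
    have e : ((j + 1 : ℕ) : ℝ≥0) - j = 1 := by
      push_cast
      rw [add_tsub_cancel_left]
    rwa [e, mul_one] at this
  have hind : iIndepFun Y P := hN.indep.nat Nat.mono_cast
  have hcast : Measurable (fun n : ℕ => (n : ℝ)) := measurable_from_nat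
  have hYint : Integrable (fun ω => (Y 0 ω : ℝ)) P := by
    have h1 := integrable_natCast_poissonMeasure rate
    rw [← (hlaw 0).map_eq] at h1
    exact h1.comp_aemeasurable (hlaw 0).aemeasurable
  have hslln := strong_law_ae_real (μ := P) (fun j ω => (Y j ω : ℝ)) hYint
    (fun i j hij => (hind.indepFun hij).comp hcast hcast)
    (fun j => (show IdentDistrib (Y j) (Y 0) P P from
      ⟨(hlaw j).aemeasurable, (hlaw 0).aemeasurable, by rw [(hlaw j).map_eq, (hlaw 0).map_eq]⟩).comp
        hcast)
  refine ⟨∫ ω, (Y 0 ω : ℝ) ∂P, ?_⟩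
  filter_upwards [hslln, hN.zero, hN.mono] with ω h1 h0 hm
  refine h1.congr fun n => ?_
  congr 1
  have : ∀ j : ℕ, (Y j ω : ℝ) = (N ((j + 1 : ℕ) : ℝ≥0) ω : ℝ) - N (j : ℝ≥0) ω := fun j => by
    rw [hY]
    exact Nat.cast_sub (hm (by simp))
  simp only [this]
  rw [Finset.sum_range_sub (fun j : ℕ => (N (j : ℝ≥0) ω : ℝ))]
  simp [h0]

/-- A function whose increments are dominated by those of a function of linear growth grows
linearly if it does so along the squares. -/
lemma tendsto_div_of_tendsto_sq {f g : ℝ≥0 → ℝ} {a c : ℝ} (hg : Monotone g)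
    (hfg : ∀ s t, s ≤ t → |f t - f s| ≤ g t - g s)
    (hf : Tendsto (fun n : ℕ => f ((n ^ 2 : ℕ) : ℝ≥0) / (n : ℝ) ^ 2) atTop (𝓝 a))
    (hgc : Tendsto (fun n : ℕ => g n / n) atTop (𝓝 c)) :
    Tendsto (fun t : ℝ≥0 => f t / t) atTop (𝓝 a) := by
  have hsq : Tendsto (fun n : ℕ => n ^ 2) atTop atTop := tendsto_pow_atTop two_ne_zero
  have hratio : Tendsto (fun n : ℕ => ((n + 1 : ℕ) : ℝ) ^ 2 / (n : ℝ) ^ 2) atTop (𝓝 1) := by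
    have h1 : Tendsto (fun n : ℕ => (1 + 1 / (n : ℝ)) ^ 2) atTop (𝓝 ((1 + 0) ^ 2)) :=
      (tendsto_one_div_atTop_nhds_zero_nat.const_add 1).pow 2
    rw [add_zero, one_pow] at h1
    refine h1.congr' ((eventually_gt_atTop 0).mono fun n hn => ?_)
    have : (n : ℝ) ≠ 0 := by positivity
    push_cast
    field_simp
  -- Linear growth of `g` and `(n + 1) ^ 2 / n ^ 2 → 1` make the increase of `g` between consecutive
  -- squares negligible against `n ^ 2`.
  have hincr : Tendsto (fun n : ℕ => (g (((n + 1) ^ 2 : ℕ) : ℝ≥0) - g ((n ^ 2 : ℕ) : ℝ≥0)) /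
      (n : ℝ) ^ 2) atTop (𝓝 0) := by
    have h1 := hgc.comp hsq
    have h2 := (h1.comp (tendsto_add_atTop_nat 1)).mul hratio
    have h3 := h2.sub h1
    rw [mul_one, sub_self] at h3
    refine h3.congr' ((eventually_gt_atTop 0).mono fun n hn => ?_)
    have : (n : ℝ) ≠ 0 := by positivity
    simp only [Function.comp_apply]
    push_cast
    field_simp
  -- `ν t ^ 2` is the last square not exceeding `t`.
  set ν : ℝ≥0 → ℕ := fun t => Nat.sqrt ⌊t⌋₊ with hν
  have hνlim : Tendsto ν atTop atTop := by
    refine Tendsto.comp (g := Nat.sqrt) ?_ tendsto_nat_floor_atTop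
    exact tendsto_atTop_mono' _ (Eventually.of_forall fun _ => le_rfl)
      (tendsto_atTop_atTop.2 fun b => ⟨b ^ 2, fun n hn => Nat.le_sqrt'.2 hn⟩)
  have hle : ∀ t, ((ν t ^ 2 : ℕ) : ℝ≥0) ≤ t := fun t =>
    (Nat.cast_le.2 (Nat.sqrt_le' _)).trans (Nat.floor_le zero_le)
  have hlt : ∀ t, t ≤ (((ν t + 1) ^ 2 : ℕ) : ℝ≥0) := fun t =>
    (Nat.lt_floor_add_one t).le.trans (by exact_mod_cast Nat.succ_le_of_lt (Nat.lt_succ_sqrt' _))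
  have hν0 : ∀ᶠ t in atTop, 0 < ν t := hνlim.eventually (eventually_gt_atTop 0)
  have hpos : ∀ t, 0 < ν t → (0 : ℝ) < (ν t : ℝ) ^ 2 ∧ (ν t : ℝ) ^ 2 ≤ t := fun t h =>
    ⟨by positivity, by exact_mod_cast hle t⟩
  have hscale : Tendsto (fun t : ℝ≥0 => (ν t : ℝ) ^ 2 / t) atTop (𝓝 1) := by
    have h1 := (hratio.comp hνlim).inv₀ one_ne_zero
    rw [inv_one] at h1
    refine tendsto_of_tendsto_of_tendsto_of_le_of_le' h1 tendsto_const_nhds ?_ ?_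
    · filter_upwards [hν0] with t ht
      obtain ⟨h1, h2⟩ := hpos t ht
      have h3 : (t : ℝ) ≤ ((ν t + 1 : ℕ) : ℝ) ^ 2 := by exact_mod_cast hlt t
      simp only [Function.comp_apply, inv_div]
      exact div_le_div_of_nonneg_left h1.le (h1.trans_le h2) h3
    · filter_upwards [hν0] with t ht
      obtain ⟨h1, h2⟩ := hpos t ht
      exact (div_le_one (h1.trans_le h2)).2 h2
  have herr : Tendsto (fun t : ℝ≥0 => (f t - f ((ν t ^ 2 : ℕ) : ℝ≥0)) / t) atTop (𝓝 0) := by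
    refine squeeze_zero_norm' ?_ (hincr.comp hνlim)
    filter_upwards [hν0] with t ht
    obtain ⟨h1, h2⟩ := hpos t ht
    rw [Real.norm_eq_abs, abs_div, abs_of_pos (h1.trans_le h2)]
    have h3 := (hfg _ _ (hle t)).trans (sub_le_sub_right (hg (hlt t)) _)
    exact div_le_div₀ ((abs_nonneg _).trans h3) h3 h1 h2
  have hmain := ((hf.comp hνlim).mul hscale).add herr
  rw [mul_one, add_zero] at hmain
  refine hmain.congr' ?_
  filter_upwards [hν0] with t ht
  obtain ⟨h1, h2⟩ := hpos t ht
  have := h1.trans_le h2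
  simp only [Function.comp_apply]
  field_simp
  ring

end Limit

end RPNG

end

theorem mainTheorem2 {Ω : Type*} [MeasurableSpace Ω] (P : Measure Ω) [IsProbabilityMeasure P]
    (lam : ℝ≥0) (hlam : 0 < lam) (N : RPNG.MarkKind → ℤ → ℝ≥0 → Ω → ℕ)
    (hN : RPNG.IsPoissonSystem N lam P) :
    ∀ᵐ ω ∂P, Tendsto
      (fun t : ℝ≥0 => (RPNG.height (fun k x s => N k x s ω) 0 t : ℝ) / (t : ℝ))
      atTop (𝓝 (lam : ℝ)) := by
  choose c hc using fun k => (hN.poisson k 0).ae_tendsto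
  filter_upwards [hN.ae_goodEnv, hN.ae_tendsto_height_sq, ae_all_iff.2 hc] with ω hg hsq hcount
  -- The dominating function counts all marks on the edge `0`; the value of its growth rate plays no
  -- role, only its existence.
  refine RPNG.tendsto_div_of_tendsto_sq (f := fun t => (RPNG.height (RPNG.env N ω) 0 t : ℝ))
    (g := fun t => ∑ k, (N k 0 t ω : ℝ)) (c := ∑ k, c k) (fun s t hst => ?_) (fun s t hst => ?_) hsq
    ?_
  · exact Finset.sum_le_sum fun k _ => Nat.cast_le.2 (hg.mono k 0 hst)
  · have h := hg.abs_height_sub_le hst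
    rw [← Finset.sum_sub_distrib]
    exact_mod_cast h
  · simp only [Finset.sum_div]
    exact tendsto_finsetSum _ fun k _ => hcount k
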